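/- Let $T$ be the first-order theory, in the language $\{E\}$ of graphs, of the simple graphs such that (0) every vertex lies on an edge; (1) every edge is contained in exactly two triangles; (2) every nonempty finite (induced) subgraph has a removable vertex, i.e. a vertex which has in this subgraph either at most one neighbour, or exactly two neighbours, these two being adjacent. Let $M\models T$. The subgraph of $M$ generated by an edge $e$ is the induced subgraph on the smallest set of vertices that contains both ends of $e$ and contains, with any two adjacent vertices, all their common neighbours (this is a copy of the Farey graph). Two edges of $M$ are equivalent if they generate the same subgraph; $\mathcal E$ is the set of equivalence classes of edges, and a vertex belongs to a class if it lies on one of the edges of the class. Let $G_{tree}(M)$ be the bipartite graph on the disjoint union of $M$ and $\mathcal E$ in which a vertex $x\in M$ is joined to $E\in\mathcal E$ if and only if $x$ belongs to $E$. For $B\subseteq M$ let $\mathrm{conv}(B)$ be the convex hull of $B$ in $G_{tree}(M)$, i.e. the smallest set of vertices of $G_{tree}(M)$ that contains $B$ and contains every shortest path between any two of its members, and let $$\mathrm{conv}_M(B)=B\cup\{x\in M : x \text{ belongs to some } E\in\mathcal E \text{ with } E\in\mathrm{conv}(B)\}.$$ Proposition. For every model $M$ of $T$ and every finite subset $A\subseteq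 M$, $$\mathrm{acl}(A)=\mathrm{conv}_M(A),$$ where $\mathrm{acl}(A)$ is the model-theoretic algebraic closure of $A$ in $M$, i.e. the union of all finite subsets of $M$ that are definable (in the language of graphs) with parameters from $A$. -/

import Mathlib

open FirstOrder FirstOrder.Language

noncomputable section

namespace FareyModel

/-! ### The theory `T` of the Farey graph, in the language of graphs -/

/-- Every vertex lies on an edge: `∀ x ∃ y, E(x,y)`. -/
def edgeAxiom : Language.graph.Sentence :=
  ∀' ∃' (adj.boundedFormula₂ (&0) (&1))

/-- Every edge is contained in exactly two triangles:
`∀ u v, E(u,v) → ∃ a b, a ≠ b ∧ ∀ w, (E(u,w) ∧ E(v,w) ↔ w = a ∨ w = b)`. -/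
def triangleAxiom : Language.graph.Sentence :=
  ∀' ∀' ((adj.boundedFormula₂ (&0) (&1)).imp
    (∃' ∃' ((∼((&2) =' (&3))) ⊓
      ∀' (((adj.boundedFormula₂ (&0) (&4)) ⊓ (adj.boundedFormula₂ (&1) (&4))).iff
        (((&4) =' (&2)) ⊔ ((&4) =' (&3)))))))

/-- The formula `E(x_i, x_j)`. -/
def edgeF {n : ℕ} (i j : Fin n) : Language.graph.Formula (Empty ⊕ Fin n) :=
  adj.formula₂ (Term.var (Sum.inr i)) (Term.var (Sum.inr j))

/-- The formula `x_i = x_j`. -/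
def eqF {n : ℕ} (i j : Fin n) : Language.graph.Formula (Empty ⊕ Fin n) :=
  Term.equal (Term.var (Sum.inr i)) (Term.var (Sum.inr j))

/-- The formula saying that `x_i` is removable from `{x_0, …, x_{n-1}}`: it has at most one
neighbour there, or exactly two neighbours there, and these two are adjacent. -/
def removableF {n : ℕ} (i : Fin n) : Language.graph.Formula (Empty ⊕ Fin n) :=
  (Formula.iInf fun p : Fin n × Fin n =>
      ((edgeF i p.1) ⊓ (edgeF i p.2)).imp (eqF p.1 p.2)) ⊔
  (Formula.iSup fun p : Fin n × Fin n =>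
      (((edgeF i p.1) ⊓ (edgeF i p.2)) ⊓ (edgeF p.1 p.2)) ⊓
        (Formula.iInf fun l : Fin n => (edgeF i l).imp ((eqF l p.1) ⊔ (eqF l p.2))))

/-- Every (induced, nonempty) subgraph on a set `{x_0, …, x_n}` has a removable vertex. -/
def removableAxiom (n : ℕ) : Language.graph.Sentence :=
  Formula.iAlls (Fin (n + 1)) (Formula.iSup fun i : Fin (n + 1) => removableF i)

/-- The theory `T`: simple graphs without isolated vertices in which every edge is contained in
exactly two triangles and every nonempty finite subgraph has a removable vertex. -/
def T : Language.graph.Theory :=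
  Theory.simpleGraph ∪ {edgeAxiom, triangleAxiom} ∪ Set.range removableAxiom

/-! ### The same axioms, read in a simple graph -/

section Graph

variable {V : Type*} (G : SimpleGraph V)

/-- `x` is removable from the subgraph of `G` induced on `S`: its valency there is at most `1`, or
it is `2` and the two neighbours form an edge. -/
def Removable (S : Set V) (x : V) : Prop :=
  x ∈ S ∧ ((S ∩ G.neighborSet x).encard ≤ 1 ∨
    ∃ y z, S ∩ G.neighborSet x = {y, z} ∧ G.Adj y z)

end Graph

theorem removableF_realize {V : Type*} (G : SimpleGraph V) {n : ℕ} (i : Fin n)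
    (v : Empty ⊕ Fin n → V) :
    letI := G.structure
    (removableF i).Realize v ↔ Removable G (Set.range fun j => v (Sum.inr j)) (v (Sum.inr i)) := by
  let := G.structure
  have hE : ∀ a b : Fin n, (edgeF a b).Realize v ↔ G.Adj (v (Sum.inr a)) (v (Sum.inr b)) := by
    intro a b
    simp only [edgeF, Formula.realize_rel₂, Term.realize_var]
    rfl
  have hq : ∀ a b : Fin n, (eqF a b).Realize v ↔ v (Sum.inr a) = v (Sum.inr b) := by
    intro a b
    simp [eqF]
  simp only [removableF, Formula.realize_sup, Formula.realize_iInf, Formula.realize_iSup,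
    Formula.realize_imp, Formula.realize_inf, hE, hq, Removable]
  constructor
  · rintro (h | ⟨p, ⟨⟨h1, h2⟩, h3⟩, h4⟩)
    · refine ⟨⟨i, rfl⟩, Or.inl ?_⟩
      rw [Set.encard_le_one_iff]
      rintro _ _ ⟨⟨a, rfl⟩, ha⟩ ⟨⟨b, rfl⟩, hb⟩
      exact h (a, b) ⟨ha, hb⟩
    · refine ⟨⟨i, rfl⟩, Or.inr ⟨_, _, ?_, h3⟩⟩
      ext w
      constructor
      · rintro ⟨⟨a, rfl⟩, ha⟩
        exact h4 a ha
      · rintro (rfl | rfl)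
        · exact ⟨⟨_, rfl⟩, h1⟩
        · exact ⟨⟨_, rfl⟩, h2⟩
  · rintro ⟨-, h | ⟨y, z, h, hyz⟩⟩
    · left
      rintro ⟨a, b⟩ ⟨ha, hb⟩
      exact Set.encard_le_one_iff.1 h _ _ ⟨⟨a, rfl⟩, ha⟩ ⟨⟨b, rfl⟩, hb⟩
    · right
      have hy : y ∈ (Set.range fun j => v (Sum.inr j)) ∩ G.neighborSet (v (Sum.inr i)) := by
        rw [h]; simp
      have hz : z ∈ (Set.range fun j => v (Sum.inr j)) ∩ G.neighborSet (v (Sum.inr i)) := by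
        rw [h]; simp
      obtain ⟨⟨a, rfl⟩, ha⟩ := hy
      obtain ⟨⟨b, rfl⟩, hb⟩ := hz
      refine ⟨(a, b), ⟨⟨ha, hb⟩, hyz⟩, fun l hl => ?_⟩
      have : v (Sum.inr l) ∈ (Set.range fun j => v (Sum.inr j)) ∩ G.neighborSet (v (Sum.inr i)) :=
        ⟨⟨l, rfl⟩, hl⟩
      rw [h] at this
      exact this

/-- A simple graph is a model of `T` exactly when it satisfies the three axioms. -/
theorem model_T_iff {V : Type*} (G : SimpleGraph V) :
    (letI := G.structure; V ⊨ T) ↔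
      (∀ x, ∃ y, G.Adj x y) ∧
      (∀ u v, G.Adj u v → {w | G.Adj u w ∧ G.Adj v w}.encard = 2) ∧
      (∀ S : Set V, S.Finite → S.Nonempty → ∃ x, Removable G S x) := by
  let := G.structure
  have hS : V ⊨ Theory.simpleGraph := simpleGraph_model G
  have hR : ∀ x y : V, Structure.RelMap adj ![x, y] ↔ G.Adj x y := fun x y => Iff.rfl
  have h1 : V ⊨ edgeAxiom ↔ ∀ x, ∃ y, G.Adj x y := by
    simp [edgeAxiom, Sentence.Realize, Formula.Realize, BoundedFormula.realize_rel₂, hR, Fin.snoc]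
  have h2 : V ⊨ triangleAxiom ↔
      ∀ u v, G.Adj u v → {w | G.Adj u w ∧ G.Adj v w}.encard = 2 := by
    simp only [triangleAxiom, Sentence.Realize, Formula.Realize, BoundedFormula.realize_all,
      BoundedFormula.realize_imp, BoundedFormula.realize_rel₂, BoundedFormula.realize_ex,
      BoundedFormula.realize_inf, BoundedFormula.realize_not, BoundedFormula.realize_iff,
      BoundedFormula.realize_sup, BoundedFormula.realize_bdEqual, Term.realize_var,
      Function.comp_apply, Sum.elim_inr, Set.encard_eq_two, Set.ext_iff]
    rfl
  have h3 : (∀ n, V ⊨ removableAxiom n) ↔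
      ∀ S : Set V, S.Finite → S.Nonempty → ∃ x, Removable G S x := by
    simp only [removableAxiom, Sentence.Realize, Formula.realize_iAlls, Formula.realize_iSup,
      removableF_realize, Sum.elim_inr]
    constructor
    · intro h S hf hne
      obtain ⟨n, e, -, rfl⟩ := hf.fin_param
      cases n with
      | zero => obtain ⟨_, ⟨a, -⟩⟩ := hne; exact a.elim0
      | succ n => obtain ⟨i, hi⟩ := h n e; exact ⟨_, hi⟩
    · intro h n e
      obtain ⟨x, hx⟩ := h (Set.range e) (Set.finite_range e) ⟨_, ⟨0, rfl⟩⟩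
      obtain ⟨i, rfl⟩ := hx.1
      exact ⟨i, hx⟩
  rw [← h1, ← h2, ← h3]
  simp only [T, Theory.model_union_iff, hS, true_and, Theory.model_insert_iff,
    Theory.model_singleton_iff, and_assoc]
  simp [Theory.model_iff]

/-! ### Equivalence of edges, the bipartite graph `G_tree`, and convex hulls -/

section Graph

variable {V : Type*} (G : SimpleGraph V)

/-- The vertices generated by an edge `e`: start with the two ends of `e` and repeatedly
add the third vertices of the triangles over edges that are already present. -/
inductive Generated (e : Sym2 V) : V → Prop
  | base {x : V} : x ∈ e → Generated e x
  | step {x y z : V} : Generated e x → Generated e y →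
      G.Adj x y → G.Adj x z → G.Adj y z → Generated e z

/-- The subgraph of `G` generated by an edge. In a graph in which every edge is contained in exactly
two triangles and every nonempty finite subgraph has a removable vertex this is a copy of
the Farey graph. -/
def generatedFarey (e : Sym2 V) : G.Subgraph :=
  (⊤ : G.Subgraph).induce {x | Generated G e x}

/-- Two edges are equivalent if they generate the same Farey graph as a subgraph. -/
def edgeSetoid : Setoid G.edgeSet where
  r e f := generatedFarey G e = generatedFarey G f
  iseqv := ⟨fun _ => rfl, fun h => h.symm, fun h h' => h.trans h'⟩

/-- The set of equivalence classes of edges. -/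
abbrev EdgeClass : Type _ := Quotient (edgeSetoid G)

variable {G} in
/-- The vertices that belong to a class, i.e. lie on one of its edges. -/
def EdgeClass.verts (E : EdgeClass G) : Set V :=
  {x | ∃ e : G.edgeSet, Quotient.mk (edgeSetoid G) e = E ∧ x ∈ (e : Sym2 V)}

/-- The bipartite graph on the vertices of `G` and the classes of edges, with a vertex joined to
the classes to which it belongs. -/
def treeGraph : SimpleGraph (V ⊕ EdgeClass G) where
  Adj
    | Sum.inl x, Sum.inr E => x ∈ E.verts
    | Sum.inr E, Sum.inl x => x ∈ E.verts
    | _, _ => False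
  symm := ⟨by rintro (x | E) (y | F) h <;> exact h⟩
  loopless := ⟨by rintro (x | E) h <;> exact h⟩

/-- A set of vertices of a graph is convex if it contains every shortest path between any two of
its members. -/
def IsConvex {W : Type*} (H : SimpleGraph W) (S : Set W) : Prop :=
  ∀ ⦃u v : W⦄, u ∈ S → v ∈ S → ∀ p : H.Walk u v, p.length = H.dist u v → ∀ w ∈ p.support, w ∈ S

/-- The convex hull: the smallest convex set containing `S`. -/
def convexHull {W : Type*} (H : SimpleGraph W) (S : Set W) : Set W :=
  ⋂₀ {C | S ⊆ C ∧ IsConvex H C}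

/-- `conv_M(B)`: the vertices that are in `B` or belong to a class lying in the convex hull of `B`
in the bipartite graph. -/
def convM (B : Set V) : Set V :=
  B ∪ {x | ∃ E : EdgeClass G, Sum.inr E ∈ convexHull (treeGraph G) (Sum.inl '' B) ∧ x ∈ E.verts}

end Graph

/-! ### Models and algebraic closure -/

/-- The simple graph underlying a model of `T`. -/
def graphOf {M : Type*} [Language.graph.Structure M] (hM : M ⊨ T) : SimpleGraph M :=
  haveI : M ⊨ Theory.simpleGraph :=
    hM.mono (Set.subset_union_left.trans Set.subset_union_left)
  simpleGraphOfStructure M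

/-- The model-theoretic algebraic closure of `A` in `M`: the union of the finite subsets of `M` that
are definable with parameters from `A`. -/
def acl (L : Language) {M : Type*} [L.Structure M] (A : Set M) : Set M :=
  {b | ∃ D : Set M, A.Definable₁ L D ∧ D.Finite ∧ b ∈ D}

end FareyModel

end

noncomputable section

namespace FareyModel

/-! ### Vanishing cohomology of finite subgraphs and what it says about walks. -/

section Combinatorics

variable {V : Type*} {G : SimpleGraph V}

/-! Removable vertices force every finite subgraph, with its triangles filled in, to have trivial
first cohomology, since a potential extends over a removable vertex (`exists_potential`). Suitable
cochains give two facts. Distinct vertices cannot be joined both inside and outside a set of edges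
that contains all or none of the edges of each triangle (`eq_of_reflTransGen`). Neighbours of `a`
joined by a walk avoiding `a` are joined within the neighbourhood of `a` (`conn_link`).

Both inclusions pass through strong sets: closed under triangles, with connectedness realised
inside. A walk using no edge of a strong set can return to it only at its starting point
(`eq_of_strong`). By this tree-like property, `convM` is the least strong set containing `A`
(`strong_convM`, `convM_subset`).

The algebraic closure is strong, because an edge has only two common neighbours and, by `conn_link`,
only finitely many geodesic first steps lead from one vertex to another. Hence it contains `convM`.

For the converse, pass to an ultrapower, where valencies are uncountable and some vertex is
unreachable from any given finite set (`rich_ultrapower`). There the finite partial isomorphisms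
`PIso` form a back-and-forth system and so preserve formulas (`PIso.realize_iff`). A vertex outside
a strong set can be moved off any finite set while a finite part of the strong set stays fixed
(`Rich.exists_conjugate`). A finite definable set gains no points in the ultrapower, so it cannot
contain such a vertex. -/

/-- The axioms of `T`, read in a simple graph. -/
structure IsFarey (G : SimpleGraph V) : Prop where
  edge : ∀ x, ∃ y, G.Adj x y
  triangle : ∀ u v, G.Adj u v → {w | G.Adj u w ∧ G.Adj v w}.encard = 2
  removable : ∀ S : Set V, S.Finite → S.Nonempty → ∃ x, Removable G S x

/-! ### Walks as reflexive transitive closures -/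

theorem reflTransGen_symm {r : V → V → Prop} (hr : ∀ a b, r a b → r b a) {a b : V}
    (h : Relation.ReflTransGen r a b) : Relation.ReflTransGen r b a := by
  induction h with
  | refl => exact .refl
  | tail _ hbc ih => exact .head (hr _ _ hbc) ih

theorem reflTransGen_mono {r r' : V → V → Prop} (hr : ∀ a b, r a b → r' a b) {a b : V}
    (h : Relation.ReflTransGen r a b) : Relation.ReflTransGen r' a b :=
  Relation.ReflTransGen.mono (r := r) (fun a b h => hr a b h) a b h

/-- A walk only visits finitely many vertices. -/
theorem reflTransGen_finite {r : V → V → Prop} {a b : V} (h : Relation.ReflTransGen r a b) :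
    ∃ Y : Set V, Y.Finite ∧ a ∈ Y ∧ b ∈ Y ∧
      Relation.ReflTransGen (fun x y => r x y ∧ x ∈ Y ∧ y ∈ Y) a b := by
  induction h with
  | refl => exact ⟨{a}, Set.finite_singleton a, rfl, rfl, .refl⟩
  | @tail b c _ hbc ih =>
    obtain ⟨Y, hY, ha, hb, h⟩ := ih
    refine ⟨insert c Y, hY.insert c, Or.inr ha, Or.inl rfl, ?_⟩
    refine .tail (reflTransGen_mono (fun x y hxy => ⟨hxy.1, Or.inr hxy.2.1, Or.inr hxy.2.2⟩) h) ?_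
    exact ⟨hbc, Or.inr hb, Or.inl rfl⟩

/-- A relation preserves the value of a function that is constant along its steps. -/
theorem reflTransGen_const {β : Type*} {r : V → V → Prop} {f : V → β}
    (hf : ∀ a b, r a b → f a = f b) {a b : V} (h : Relation.ReflTransGen r a b) : f a = f b := by
  induction h with
  | refl => rfl
  | tail _ hbc ih => exact ih.trans (hf _ _ hbc)

/-- A walk that leaves a set has a step out of it. -/
theorem reflTransGen_boundary {r : V → V → Prop} {P : V → Prop} {a b : V}
    (h : Relation.ReflTransGen r a b) (ha : P a) (hb : ¬ P b) :
    ∃ c d, Relation.ReflTransGen r a c ∧ r c d ∧ P c ∧ ¬ P d := by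
  induction h with
  | refl => exact absurd ha hb
  | @tail b c hab hbc ih =>
    by_cases hPb : P b
    · exact ⟨b, c, hab, hbc, hPb, hb⟩
    · exact ih hPb

variable (G) in
/-- `u` and `v` are joined by a walk inside `S`. -/
def Conn (S : Set V) : V → V → Prop :=
  Relation.ReflTransGen fun a b => G.Adj a b ∧ a ∈ S ∧ b ∈ S

theorem Conn.symm {S : Set V} {a b : V} (h : Conn G S a b) : Conn G S b a :=
  reflTransGen_symm (fun _ _ h => ⟨h.1.symm, h.2.2, h.2.1⟩) h

theorem Conn.trans {S : Set V} {a b c : V} (h : Conn G S a b) (h' : Conn G S b c) :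
    Conn G S a c :=
  Relation.ReflTransGen.trans h h'

theorem Conn.mono {S S' : Set V} (hS : S ⊆ S') {a b : V} (h : Conn G S a b) : Conn G S' a b :=
  reflTransGen_mono (fun _ _ h => ⟨h.1, hS h.2.1, hS h.2.2⟩) h

theorem Conn.single {S : Set V} {a b : V} (h : G.Adj a b) (ha : a ∈ S) (hb : b ∈ S) :
    Conn G S a b :=
  Relation.ReflTransGen.single ⟨h, ha, hb⟩

theorem Conn.mem_right {S : Set V} {a b : V} (h : Conn G S a b) (ha : a ∈ S) : b ∈ S := by
  cases h with
  | refl => exact ha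
  | tail _ h => exact h.2.2

/-! ### Exactness of cochains -/

namespace IsFarey

variable (hG : IsFarey G)
include hG

/-- A cochain on a finite induced subgraph which is closed on its triangles is a coboundary. -/
theorem exists_potential {Y : Set V} (hY : Y.Finite) (c : V → V → ℤ)
    (hanti : ∀ x y, c y x = - c x y)
    (htri : ∀ x ∈ Y, ∀ y ∈ Y, ∀ z ∈ Y, G.Adj x y → G.Adj x z → G.Adj y z →
      c x y + c y z = c x z) :
    ∃ h : V → ℤ, ∀ x ∈ Y, ∀ y ∈ Y, G.Adj x y → c x y = h y - h x := by
  classical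
  induction hn : Y.ncard generalizing Y with
  | zero =>
    rw [Set.ncard_eq_zero hY] at hn
    subst hn
    exact ⟨0, by simp⟩
  | succ n ih =>
    have hne : Y.Nonempty := by
      rw [Set.nonempty_iff_ne_empty]
      rintro rfl
      simp at hn
    obtain ⟨v, hv, hrem⟩ := hG.removable Y hY hne
    obtain ⟨h, hh⟩ := ih (Y := Y \ {v}) (hY.sdiff)
      (fun x hx y hy z hz => htri x hx.1 y hy.1 z hz.1)
      (by rw [Set.ncard_sdiff_singleton_of_mem hv, hn]; rfl)
    -- Each neighbour of `v` prescribes a value at `v`. A clash needs two neighbours, and then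
    -- closedness on the triangle they form with `v` rules it out.
    obtain ⟨val, hval⟩ : ∃ val : ℤ, ∀ u ∈ Y, G.Adj v u → c u v = val - h u := by
      rcases hrem with h1 | ⟨y, z, hyz, hadj⟩
      · rcases Set.encard_le_one_iff_eq.1 h1 with h0 | ⟨u, hu⟩
        · refine ⟨0, fun u huY hvu => ?_⟩
          have : u ∈ Y ∩ G.neighborSet v := ⟨huY, hvu⟩
          rw [h0] at this
          exact this.elim
        · refine ⟨h u + c u v, fun w hwY hvw => ?_⟩
          have : w ∈ Y ∩ G.neighborSet v := ⟨hwY, hvw⟩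
          rw [hu] at this
          rw [Set.mem_singleton_iff.1 this]
          ring
      · have hy : y ∈ Y ∩ G.neighborSet v := by rw [hyz]; simp
        have hz : z ∈ Y ∩ G.neighborSet v := by rw [hyz]; simp
        have hzv : z ≠ v := fun e => G.loopless.irrefl v (e ▸ hz.2)
        have hyv : y ≠ v := fun e => G.loopless.irrefl v (e ▸ hy.2)
        have h1 := hh y ⟨hy.1, hyv⟩ z ⟨hz.1, hzv⟩ hadj
        have h2 := htri y hy.1 z hz.1 v hv hadj hy.2.symm hz.2.symm
        refine ⟨h y + c y v, fun w hwY hvw => ?_⟩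
        have : w ∈ Y ∩ G.neighborSet v := ⟨hwY, hvw⟩
        rw [hyz] at this
        rcases this with rfl | rfl
        · ring
        · linarith
    refine ⟨Function.update h v val, fun x hx y hy hxy => ?_⟩
    by_cases hxv : x = v
    · subst hxv
      have hyx : y ≠ x := hxy.ne'
      rw [Function.update_self, Function.update_of_ne hyx, hanti y x, hval y hy hxy]
      ring
    · by_cases hyv : y = v
      · subst hyv
        rw [Function.update_self, Function.update_of_ne hxv, hval x hx hxy.symm]
      · rw [Function.update_of_ne hxv, Function.update_of_ne hyv]
        exact hh x ⟨hx, hxv⟩ y ⟨hy, hyv⟩ hxy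

/-- Two vertices that are joined both by a walk in a triangle-closed set of edges and by a walk
outside of it are equal. -/
theorem eq_of_reflTransGen {E : V → V → Prop} (hsymm : ∀ a b, E a b → E b a)
    (hE : ∀ a b c, G.Adj a b → G.Adj a c → G.Adj b c → E a b → E a c) {s t : V}
    (h1 : Relation.ReflTransGen (fun a b => G.Adj a b ∧ E a b) s t)
    (h2 : Relation.ReflTransGen (fun a b => G.Adj a b ∧ ¬ E a b) s t) : s = t := by
  classical
  by_contra hst
  obtain ⟨Y1, hY1, -, -, hr1⟩ := reflTransGen_finite h1
  obtain ⟨Y2, hY2, -, -, hr2⟩ := reflTransGen_finite h2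
  set p : V → ℤ := fun x => if x = s then 1 else 0 with hp
  -- The coboundary of the indicator of `s`, cut off outside `E`; it stays closed because no
  -- triangle is split by `E`. Its potential differs from `p` by a constant along the first walk and
  -- is constant along the second, so `p s = p t`.
  set c : V → V → ℤ := fun x y => if E x y then p y - p x else 0 with hc
  have hcE : ∀ x y, E x y → c x y = p y - p x := fun x y h => if_pos h
  have hcN : ∀ x y, ¬ E x y → c x y = 0 := fun x y h => if_neg h
  obtain ⟨h, hh⟩ := hG.exists_potential (hY1.union hY2) c
    (fun x y => by
      by_cases hxy : E x y
      · rw [hcE _ _ hxy, hcE _ _ (hsymm _ _ hxy)]; ring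
      · rw [hcN _ _ hxy, hcN _ _ fun h => hxy (hsymm _ _ h)]; ring)
    (fun x _ y _ z _ hxy hxz hyz => by
      by_cases hE' : E x y
      · have hxz' := hE _ _ _ hxy hxz hyz hE'
        have hyz' := hE _ _ _ hxy.symm hyz hxz (hsymm _ _ hE')
        rw [hcE _ _ hE', hcE _ _ hxz', hcE _ _ hyz']; ring
      · have hxz' : ¬ E x z := fun h => hE' (hE _ _ _ hxz hxy hyz.symm h)
        have hyz' : ¬ E y z := fun h =>
          hE' (hsymm _ _ (hE _ _ _ hyz hxy.symm hxz.symm h))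
        rw [hcN _ _ hE', hcN _ _ hxz', hcN _ _ hyz']; ring)
  have e1 : h s - p s = h t - p t :=
    reflTransGen_const (f := fun x => h x - p x) (fun a b hab => by
      have := hh a (Or.inl hab.2.1) b (Or.inl hab.2.2) hab.1.1
      rw [hcE _ _ hab.1.2] at this
      linarith) hr1
  have e2 : h s = h t :=
    reflTransGen_const (f := h) (fun a b hab => by
      have := hh a (Or.inr hab.2.1) b (Or.inr hab.2.2) hab.1.1
      rw [hcN _ _ hab.1.2] at this
      linarith) hr2
  have hps : p s = 1 := by simp [hp]
  have hpt : p t = 0 := by simp [hp, Ne.symm hst]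
  omega

/-- Two neighbours of a vertex that are joined by a walk avoiding this vertex are joined by
a walk in its neighbourhood. -/
theorem conn_link {a v w : V} {S : Set V} (haS : a ∉ S) (hv : G.Adj a v) (hw : G.Adj a w)
    (hvS : v ∈ S) (h : Conn G S v w) : Conn G (G.neighborSet a ∩ S) v w := by
  classical
  by_contra hcon
  have hwS := h.mem_right hvS
  have hsub : ∃ Y : Set V, Y.Finite ∧ v ∈ Y ∧ w ∈ Y ∧ Y ⊆ S ∧ Conn G Y v w := by
    obtain ⟨Y, hY, hvY, hwY, hr⟩ := reflTransGen_finite h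
    refine ⟨Y ∩ S, hY.inter_of_left _, ⟨hvY, hvS⟩, ⟨hwY, hwS⟩, Set.inter_subset_right, ?_⟩
    exact reflTransGen_mono
      (fun x y hxy => ⟨hxy.1.1, ⟨hxy.2.1, hxy.1.2.1⟩, ⟨hxy.2.2, hxy.1.2.2⟩⟩) hr
  obtain ⟨Y, hY, hvY, hwY, hYS, hr⟩ := hsub
  have haY : a ∉ Y := fun h => haS (hYS h)
  set q : V → ℤ := fun x => if Conn G (G.neighborSet a ∩ S) v x then 1 else 0 with hq
  -- Supported on the edges at `a`, and closed because `q` is constant on components of the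
  -- neighbourhood. A potential is constant along the walk avoiding `a`, which forces `q v = q w`.
  set c : V → V → ℤ := fun x y => (if x = a then q y else 0) - (if y = a then q x else 0) with hc
  have hqe : ∀ x ∈ Y, ∀ y ∈ Y, G.Adj a x → G.Adj a y → G.Adj x y → q x = q y := by
    intro x hx y hy hax hay hxy
    have : Conn G (G.neighborSet a ∩ S) v x ↔ Conn G (G.neighborSet a ∩ S) v y :=
      ⟨fun h => h.trans (.single hxy ⟨hax, hYS hx⟩ ⟨hay, hYS hy⟩),
        fun h => h.trans (.single hxy.symm ⟨hay, hYS hy⟩ ⟨hax, hYS hx⟩)⟩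
    simp only [hq, this]
  obtain ⟨h, hh⟩ := hG.exists_potential (hY.insert a) c (fun x y => by simp only [hc]; ring)
    (fun x hx y hy z hz hxy hxz hyz => by
      have key : ∀ u ∈ insert a Y, u ≠ a → u ∈ Y := fun u hu hne => hu.resolve_left hne
      by_cases hxa : x = a
      · subst hxa
        have := hqe y (key y hy hxy.ne') z (key z hz hxz.ne') hxy hxz hyz
        simp [hc, hxy.ne', hxz.ne', this]
      · by_cases hya : y = a
        · subst hya
          have := hqe x (key x hx hxa) z (key z hz hyz.ne') hxy.symm hyz hxz
          simp [hc, hxa, hyz.ne', this]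
        · by_cases hza : z = a
          · subst hza
            have := hqe x (key x hx hxa) y (key y hy hya) hxz.symm hyz.symm hxy
            simp [hc, hxa, hya, this]
          · simp [hc, hxa, hya, hza])
  have e : h v = h w :=
    reflTransGen_const (f := h) (fun x y hxy => by
      have := hh x (Or.inr hxy.2.1) y (Or.inr hxy.2.2) hxy.1
      have hxa : x ≠ a := fun e => haY (e ▸ hxy.2.1)
      have hya : y ≠ a := fun e => haY (e ▸ hxy.2.2)
      simp only [hc, hxa, hya, if_false] at this
      linarith) hr
  have h1 := hh a (Or.inl rfl) v (Or.inr hvY) hv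
  have h2 := hh a (Or.inl rfl) w (Or.inr hwY) hw
  have hva : v ≠ a := hv.ne'
  have hwa : w ≠ a := hw.ne'
  have hqv : q v = 1 := if_pos .refl
  have hqw : q w = 0 := if_neg hcon
  simp only [hc, hva, hwa, if_true, if_false, hqv, hqw] at h1 h2
  omega

/-- There is no finite wheel. -/
theorem not_wheel {x : V} {U : Set V} (hU : U.Finite) (hne : U.Nonempty)
    (hx : U ⊆ G.neighborSet x)
    (h2 : ∀ u ∈ U, ∃ a ∈ U, ∃ b ∈ U, a ≠ b ∧ G.Adj u a ∧ G.Adj u b) : False := by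
  -- Three neighbours prevent removability. A rim vertex sees the apex `x` and two rim vertices; the
  -- apex sees a rim vertex together with its two rim neighbours.
  have key : ∀ v, (∃ a ∈ insert x U, ∃ b ∈ insert x U, ∃ c ∈ insert x U, a ≠ b ∧ a ≠ c ∧ b ≠ c ∧
      G.Adj v a ∧ G.Adj v b ∧ G.Adj v c) → ¬ Removable G (insert x U) v := by
    rintro v ⟨a, ha, b, hb, c, hc, hab, hac, hbc, hva, hvb, hvc⟩ ⟨-, h | ⟨y, z, h, -⟩⟩
    · rw [Set.encard_le_one_iff] at h
      exact hab (h a b ⟨ha, hva⟩ ⟨hb, hvb⟩)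
    · have ha' : a ∈ insert x U ∩ G.neighborSet v := ⟨ha, hva⟩
      have hb' : b ∈ insert x U ∩ G.neighborSet v := ⟨hb, hvb⟩
      have hc' : c ∈ insert x U ∩ G.neighborSet v := ⟨hc, hvc⟩
      rw [h] at ha' hb' hc'
      simp only [Set.mem_insert_iff, Set.mem_singleton_iff] at ha' hb' hc'
      rcases ha' with rfl | rfl <;> rcases hb' with rfl | rfl <;> rcases hc' with rfl | rfl <;>
        simp_all
  obtain ⟨v, hv⟩ := hG.removable (insert x U) (hU.insert x) (Set.insert_nonempty _ _)
  rcases hv.1 with rfl | hvU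
  · obtain ⟨u, hu⟩ := hne
    obtain ⟨a, ha, b, hb, hab, hua, hub⟩ := h2 u hu
    exact key v ⟨u, Or.inr hu, a, Or.inr ha, b, Or.inr hb, hua.ne, hub.ne, hab, hx hu, hx ha, hx hb⟩
      hv
  · obtain ⟨a, ha, b, hb, hab, hua, hub⟩ := h2 v hvU
    exact key v ⟨x, Or.inl rfl, a, Or.inr ha, b, Or.inr hb, (hx ha).ne, (hx hb).ne, hab,
      (hx hvU).symm, hua, hub⟩ hv

/-- The common neighbours of the ends of an edge. -/
theorem exists_triangle {u v : V} (h : G.Adj u v) :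
    ∃ a b, a ≠ b ∧ ∀ w, G.Adj u w ∧ G.Adj v w ↔ w = a ∨ w = b := by
  obtain ⟨a, b, hab, h⟩ := Set.encard_eq_two.1 (hG.triangle u v h)
  exact ⟨a, b, hab, fun w => by rw [Set.ext_iff] at h; simpa using h w⟩

/-- Every vertex has infinitely many neighbours. -/
theorem infinite_neighborSet (x : V) : (G.neighborSet x).Infinite := by
  intro hfin
  -- A finite neighbourhood would itself be the rim of a wheel: the two triangles over each spoke
  -- supply the rim neighbours.
  refine hG.not_wheel hfin (hG.edge x) subset_rfl fun u hu => ?_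
  obtain ⟨a, b, hab, h⟩ := hG.exists_triangle hu
  have ha := (h a).2 (Or.inl rfl)
  have hb := (h b).2 (Or.inr rfl)
  exact ⟨a, ha.1, b, hb.1, hab, ha.2, hb.2⟩

/-- The neighbourhood of a vertex has no circuits: the two neighbours of `z` in the neighbourhood
of `x` are not joined in this neighbourhood by a walk avoiding `z`. -/
theorem not_conn_link {x z y w : V} {S : Set V} (hz : G.Adj x z) (hy : G.Adj x y) (hw : G.Adj x w)
    (hzy : G.Adj z y) (hzw : G.Adj z w) (hyw : y ≠ w) (hzS : z ∉ S)
    (h : Conn G (G.neighborSet x ∩ S) y w) : False := by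
  classical
  let L : SimpleGraph V :=
    { Adj := fun a b => G.Adj a b ∧ G.Adj x a ∧ G.Adj x b
      symm := ⟨fun a b h => ⟨h.1.symm, h.2.2, h.2.1⟩⟩
      loopless := ⟨fun a h => G.loopless.irrefl a h.1⟩ }
  -- A cycle in the neighbourhood graph would be the rim of a wheel, so all its edges are bridges;
  -- going from `z` to `w` and on to `y` would bypass this one.
  have hbr : L.IsBridge s(z, y) := by
    have he : s(z, y) ∈ L.edgeSet := L.mem_edgeSet.2 ⟨hzy, hz, hy⟩
    rw [SimpleGraph.isBridge_iff_forall_cycle_notMem he]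
    intro u p hp _
    refine hG.not_wheel (x := x) (U := {a | a ∈ p.support}) (List.finite_toSet _)
      ⟨u, p.start_mem_support⟩ ?_ ?_
    · intro a ha
      have h2 := hp.ncard_neighborSet_toSubgraph_eq_two ha
      obtain ⟨c, d, -, hcd⟩ := Set.ncard_eq_two.1 h2
      have hc : c ∈ p.toSubgraph.neighborSet a := by rw [hcd]; simp
      exact (p.toSubgraph.adj_sub hc).2.1
    · intro a ha
      have h2 := hp.ncard_neighborSet_toSubgraph_eq_two ha
      obtain ⟨c, d, hne, hcd⟩ := Set.ncard_eq_two.1 h2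
      have hc : c ∈ p.toSubgraph.neighborSet a := by rw [hcd]; simp
      have hd : d ∈ p.toSubgraph.neighborSet a := by rw [hcd]; simp
      exact ⟨c, (p.mem_verts_toSubgraph).1 (p.toSubgraph.edge_vert hc.symm), d,
        (p.mem_verts_toSubgraph).1 (p.toSubgraph.edge_vert hd.symm), hne,
        (p.toSubgraph.adj_sub hc).1, (p.toSubgraph.adj_sub hd).1⟩
  rw [SimpleGraph.isBridge_iff] at hbr
  have hzw' : (L.deleteEdges {s(z, y)}).Adj z w := by
    rw [SimpleGraph.deleteEdges_adj]
    refine ⟨⟨hzw, hz, hw⟩, ?_⟩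
    simp only [Set.mem_singleton_iff, Sym2.eq_iff]
    rintro (⟨-, h⟩ | ⟨-, h⟩)
    · exact hyw h.symm
    · exact hzw.ne h.symm
  refine hbr (hzw'.reachable.trans ?_)
  rw [SimpleGraph.reachable_iff_reflTransGen]
  refine reflTransGen_mono ?_ h.symm
  rintro a b ⟨hab, ⟨hxa, haS⟩, ⟨hxb, hbS⟩⟩
  rw [SimpleGraph.deleteEdges_adj]
  refine ⟨⟨hab, hxa, hxb⟩, ?_⟩
  simp only [Set.mem_singleton_iff, Sym2.eq_iff]
  rintro (⟨h, -⟩ | ⟨-, h⟩)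
  · exact hzS (h ▸ haS)
  · exact hzS (h ▸ hbS)

end IsFarey

end Combinatorics

/-! ### Strong sets, Farey subgraphs generated by an edge, and distances. -/

section Strong

variable {V : Type*} {G : SimpleGraph V}

/-! ### Triangle closure and strong sets -/

variable (G) in
/-- The closure of a set of vertices under common neighbours of adjacent vertices. -/
inductive TCl (X : Set V) : Set V
  | base {x : V} : x ∈ X → TCl X x
  | step {x y z : V} : TCl X x → TCl X y → G.Adj x y → G.Adj x z → G.Adj y z → TCl X z

theorem subset_tcl (X : Set V) : X ⊆ TCl G X := fun _ h => .base h

theorem mem_tcl_of_triangle {X : Set V} {x y z : V} (hx : x ∈ TCl G X) (hy : y ∈ TCl G X)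
    (hxy : G.Adj x y) (hxz : G.Adj x z) (hyz : G.Adj y z) : z ∈ TCl G X :=
  TCl.step hx hy hxy hxz hyz

variable (G) in
/-- `S` is closed under common neighbours of adjacent vertices. -/
def TriClosed (S : Set V) : Prop :=
  ∀ ⦃x y z⦄, x ∈ S → y ∈ S → G.Adj x y → G.Adj x z → G.Adj y z → z ∈ S

theorem triClosed_tcl (X : Set V) : TriClosed G (TCl G X) :=
  fun _ _ _ => mem_tcl_of_triangle

theorem tcl_subset {X S : Set V} (hS : TriClosed G S) (hX : X ⊆ S) : TCl G X ⊆ S := by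
  intro v hv
  induction hv with
  | base h => exact hX h
  | step _ _ h1 h2 h3 ih1 ih2 => exact hS ih1 ih2 h1 h2 h3

theorem tcl_mono {X Y : Set V} (h : X ⊆ Y) : TCl G X ⊆ TCl G Y :=
  tcl_subset (triClosed_tcl Y) (h.trans (subset_tcl Y))

/-- A vertex of the triangle closure of `X` is joined to `X` inside the closure. -/
theorem exists_conn_of_mem_tcl {X : Set V} {v : V} (hv : v ∈ TCl G X) :
    ∃ x ∈ X, Conn G (TCl G X) x v := by
  induction hv with
  | base h => exact ⟨_, h, .refl⟩
  | step hx hy hxy hxz hyz ih1 _ =>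
    obtain ⟨x, hx', h⟩ := ih1
    exact ⟨x, hx', h.trans (.single hxz hx (TCl.step hx hy hxy hxz hyz))⟩

variable (G) in
/-- A set of vertices is strong if it is closed under common neighbours of adjacent vertices and
any two of its members that are joined by a walk are joined by a walk inside the set. -/
structure Strong (S : Set V) : Prop where
  tri : TriClosed G S
  conn : ∀ s ∈ S, ∀ t ∈ S, Conn G Set.univ s t → Conn G S s t

theorem strong_univ : Strong G Set.univ := ⟨fun _ _ _ _ _ _ _ _ => trivial, fun _ _ _ _ h => h⟩

/-- Every vertex of the closure is joined to `X` inside the closure, so connectedness need only be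
tested on `X`. -/
theorem strong_tcl {X : Set V}
    (hX : ∀ s ∈ X, ∀ t ∈ X, Conn G Set.univ s t → Conn G (TCl G X) s t) : Strong G (TCl G X) := by
  refine ⟨triClosed_tcl X, fun s hs t ht hst => ?_⟩
  obtain ⟨x, hx, hxs⟩ := exists_conn_of_mem_tcl hs
  obtain ⟨y, hy, hyt⟩ := exists_conn_of_mem_tcl ht
  exact hxs.symm.trans ((hX x hx y hy (((hxs.mono (Set.subset_univ _)).trans hst).trans
    (hyt.mono (Set.subset_univ _)).symm)).trans hyt)

theorem strong_tcl_edge {x y : V} (h : G.Adj x y) : Strong G (TCl G {x, y}) := by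
  have hx : x ∈ TCl G {x, y} := .base (by simp)
  have hy : y ∈ TCl G {x, y} := .base (by simp)
  refine strong_tcl ?_
  rintro _ (rfl | rfl) _ (rfl | rfl) -
  · exact .refl
  · exact .single h hx hy
  · exact .single h.symm hy hx
  · exact .refl

/-- The triangle closure of a countable set is countable. -/
theorem countable_tcl (hG : IsFarey G) {X : Set V} (hX : X.Countable) : (TCl G X).Countable := by
  let f : Set V → Set V := fun Y =>
    Y ∪ ⋃ p ∈ {p : V × V | p ∈ Y ×ˢ Y ∧ G.Adj p.1 p.2}, {w | G.Adj p.1 w ∧ G.Adj p.2 w}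
  let Z : ℕ → Set V := fun n => f^[n] X
  have hZs : ∀ n, Z (n + 1) = f (Z n) := fun n => Function.iterate_succ_apply' f n X
  have hmono : Monotone Z := monotone_nat_of_le_succ fun n => by
    rw [hZs]; exact Set.subset_union_left
  have hcount : ∀ n, (Z n).Countable := by
    intro n
    induction n with
    | zero => exact hX
    | succ n ih =>
      rw [hZs]
      refine ih.union (Set.Countable.biUnion ((ih.prod ih).mono fun p hp => hp.1) fun p hp => ?_)
      exact (Set.finite_of_encard_eq_coe (k := 2) (hG.triangle _ _ hp.2)).countable
  refine (Set.countable_iUnion hcount).mono (tcl_subset ?_ (Set.subset_iUnion Z 0))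
  intro x y z hx hy hxy hxz hyz
  obtain ⟨m, hm⟩ := Set.mem_iUnion.1 hx
  obtain ⟨n, hn⟩ := Set.mem_iUnion.1 hy
  refine Set.mem_iUnion.2 ⟨max m n + 1, ?_⟩
  rw [hZs]
  refine Or.inr (Set.mem_biUnion (x := (x, y)) ⟨⟨hmono (le_max_left m n) hm,
    hmono (le_max_right m n) hn⟩, hxy⟩ ⟨hxz, hyz⟩)

namespace IsFarey

variable (hG : IsFarey G)
include hG

/-- A walk that uses no edge of a strong set does not join two of its members. -/
theorem eq_of_strong {S : Set V} (hS : Strong G S) {s t : V} (hs : s ∈ S) (ht : t ∈ S)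
    (h : Relation.ReflTransGen (fun a b => G.Adj a b ∧ ¬ (a ∈ S ∧ b ∈ S)) s t) : s = t := by
  refine hG.eq_of_reflTransGen (E := fun a b => a ∈ S ∧ b ∈ S) (fun a b h => ⟨h.2, h.1⟩)
    (fun a b c hab hac hbc h => ⟨h.1, hS.tri h.1 h.2 hab hac hbc⟩) ?_ h
  exact hS.conn s hs t ht (reflTransGen_mono (fun a b h => ⟨h.1, trivial, trivial⟩) h)

/-- A vertex outside of a strong set has at most one neighbour in it. -/
theorem eq_of_adj_strong {S : Set V} (hS : Strong G S) {x y w : V} (hy : y ∉ S) (hx : x ∈ S)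
    (hw : w ∈ S) (hxy : G.Adj y x) (hwy : G.Adj y w) : w = x := by
  refine hG.eq_of_strong hS hw hx (.head (b := y) ⟨hwy.symm, fun h => hy h.2⟩ ?_)
  exact .single ⟨hxy, fun h => hy h.1⟩

/-- Any edge inside the set generated by an edge generates the same set. -/
theorem subset_tcl_of_adj {x y u v : V} (hxy : G.Adj x y) (huv : G.Adj u v)
    (hu : u ∈ TCl G {x, y}) (hv : v ∈ TCl G {x, y}) : {x, y} ⊆ TCl G {u, v} := by
  -- Reversible moves on oriented edges: flip, or rotate about the first end across a triangle. The
  -- edges reached from `(x, y)` are triangle-closed and connected, so an unreached edge between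
  -- vertices of the closure would have equal ends. Thus `(u, v)` is reached, and reversing the
  -- moves generates `x` and `y` from it.
  let r : V × V → V × V → Prop := fun p q => G.Adj p.1 p.2 ∧
    (q = p.swap ∨ q.1 = p.1 ∧ G.Adj p.1 q.2 ∧ G.Adj p.2 q.2)
  have hr : ∀ p q, r p q → r q p := by
    rintro ⟨a, b⟩ ⟨c, d⟩ ⟨h, h' | ⟨h1, h2, h3⟩⟩
    · simp only [Prod.swap_prod_mk, Prod.mk.injEq] at h'
      obtain ⟨rfl, rfl⟩ := h'
      exact ⟨h.symm, Or.inl rfl⟩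
    · simp only at h1 h2 h3 h
      subst h1
      exact ⟨h2, Or.inr ⟨rfl, h, h3.symm⟩⟩
  let Q : V → V → Prop := fun a b => Relation.ReflTransGen r (x, y) (a, b)
  have hQadj : ∀ a b, Q a b → G.Adj a b := by
    intro a b h
    cases h with
    | refl => exact hxy
    | tail _ h => exact (hr _ _ h).1
  have hQsymm : ∀ a b, Q a b → Q b a := fun a b h => .tail h ⟨hQadj a b h, Or.inl rfl⟩
  have hQtri : ∀ a b c, G.Adj a b → G.Adj a c → G.Adj b c → Q a b → Q a c :=
    fun a b c hab hac hbc h => .tail h ⟨hab, Or.inr ⟨rfl, hac, hbc⟩⟩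
  have hQconn : ∀ p : V × V, Relation.ReflTransGen r (x, y) p →
      Relation.ReflTransGen (fun a b => G.Adj a b ∧ Q a b) x p.1 := by
    intro p hp
    induction hp with
    | refl => exact .refl
    | @tail p q hp hpq ih =>
      obtain ⟨h, rfl | ⟨h1, -, -⟩⟩ := hpq
      · exact .tail ih ⟨h, hp⟩
      · rw [h1]; exact ih
  have hQedge : ∀ a b c d, Q a c → Q b d → G.Adj a b → Q a b := by
    intro a b c d ha hb hab
    by_contra hn
    refine hab.ne (hG.eq_of_reflTransGen hQsymm hQtri ?_ (.single ⟨hab, hn⟩))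
    exact (reflTransGen_symm (fun a b h => ⟨h.1.symm, hQsymm _ _ h.2⟩) (hQconn _ ha)).trans
      (hQconn _ hb)
  have hQmem : ∀ a ∈ TCl G {x, y}, ∃ b, Q a b := by
    intro a ha
    induction ha with
    | base h =>
      rcases h with rfl | rfl
      · exact ⟨y, .refl⟩
      · exact ⟨x, hQsymm _ _ .refl⟩
    | step _ _ h1 h2 h3 ih1 ih2 =>
      obtain ⟨c, hc⟩ := ih1
      obtain ⟨d, hd⟩ := ih2
      exact ⟨_, hQsymm _ _ (hQtri _ _ _ h1 h2 h3 (hQedge _ _ _ _ hc hd h1))⟩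
  obtain ⟨c, hc⟩ := hQmem u hu
  obtain ⟨d, hd⟩ := hQmem v hv
  have hback : Relation.ReflTransGen r (u, v) (x, y) := by
    have := hQedge u v c d hc hd huv
    clear * - this hr
    exact reflTransGen_symm hr this
  have : ∀ p : V × V, Relation.ReflTransGen r (u, v) p →
      p.1 ∈ TCl G {u, v} ∧ p.2 ∈ TCl G {u, v} := by
    intro p hp
    induction hp with
    | refl => exact ⟨.base (by simp), .base (by simp)⟩
    | @tail p q _ hpq ih =>
      obtain ⟨h, rfl | ⟨h1, h2, h3⟩⟩ := hpq
      · exact ⟨ih.2, ih.1⟩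
      · rw [h1]; exact ⟨ih.1, TCl.step ih.1 ih.2 h h2 h3⟩
  have := this _ hback
  rintro _ (rfl | rfl)
  exacts [this.1, this.2]

theorem tcl_eq_of_adj {x y u v : V} (hxy : G.Adj x y) (huv : G.Adj u v)
    (hu : u ∈ TCl G {x, y}) (hv : v ∈ TCl G {x, y}) : TCl G {u, v} = TCl G {x, y} := by
  refine (tcl_subset (triClosed_tcl _) ?_).antisymm
    (tcl_subset (triClosed_tcl _) (hG.subset_tcl_of_adj hxy huv hu hv))
  rintro _ (rfl | rfl)
  exacts [hu, hv]

/-! ### Geodesics -/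

/-- Two neighbours of `a` that are joined by a walk meeting the neighbourhood of `a` only in its
ends are adjacent. -/
theorem adj_of_conn {a v w : V} {S : Set V} (hv : G.Adj a v) (hw : G.Adj a w) (hne : v ≠ w)
    (haS : a ∉ S) (hvS : v ∈ S) (hS : ∀ u ∈ S, G.Adj a u → u = v ∨ u = w) (h : Conn G S v w) :
    G.Adj v w := by
  have h' := hG.conn_link haS hv hw hvS h
  rcases Relation.ReflTransGen.cases_head h' with rfl | ⟨c, ⟨hvc, -, hc⟩, -⟩
  · exact absurd rfl hne
  · rcases hS c hc.2 hc.1 with rfl | rfl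
    · exact absurd rfl hvc.ne
    · exact hvc

omit hG in
theorem exists_adj_dist {v b : V} {n : ℕ} (h : G.Reachable v b) (hn : G.dist v b = n + 1) :
    ∃ u, G.Adj v u ∧ G.Reachable u b ∧ G.dist u b = n := by
  obtain ⟨p, hp⟩ := h.exists_walk_length_eq_dist
  cases p with
  | nil => rw [SimpleGraph.dist_self] at hn; omega
  | @cons _ u _ hvu q =>
    rw [SimpleGraph.Walk.length_cons] at hp
    have h1 := SimpleGraph.dist_le q
    obtain ⟨q', hq'⟩ := q.reachable.exists_walk_length_eq_dist
    have h2 := SimpleGraph.dist_le (SimpleGraph.Walk.cons hvu q')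
    rw [SimpleGraph.Walk.length_cons] at h2
    exact ⟨u, hvu, q.reachable, by omega⟩

omit hG in
theorem dist_le_of_adj {v u b : V} (h : G.Reachable u b) (hvu : G.Adj v u) :
    G.dist v b ≤ G.dist u b + 1 := by
  obtain ⟨q', hq'⟩ := h.exists_walk_length_eq_dist
  have h2 := SimpleGraph.dist_le (SimpleGraph.Walk.cons hvu q')
  rw [SimpleGraph.Walk.length_cons] at h2
  omega

omit hG in
/-- A geodesic from `v` to `b` stays closer to `b` than `v`. -/
theorem conn_of_dist {v b : V} {n : ℕ} (h : G.Reachable v b) (hn : G.dist v b = n) :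
    Conn G ({v} ∪ {u | G.Reachable u b ∧ G.dist u b < n}) v b := by
  induction n generalizing v with
  | zero => rw [h.dist_eq_zero_iff.1 hn]; exact .refl
  | succ n ih =>
    obtain ⟨u, hvu, hub, hd⟩ := exists_adj_dist h hn
    have hu : u ∈ {v} ∪ {u | G.Reachable u b ∧ G.dist u b < n + 1} :=
      Or.inr ⟨hub, by omega⟩
    refine (Conn.single hvu (Or.inl rfl) hu).trans ((ih hub hd).mono ?_)
    rintro w (rfl | hw)
    · exact hu
    · exact Or.inr ⟨hw.1, by have := hw.2; omega⟩

/-- The first vertices of geodesics from `a` to `b` are pairwise adjacent. -/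
theorem adj_of_geodesic {a b v w : V} {n : ℕ} (hab : G.dist a b = n + 1)
    (hv : G.Adj a v) (hw : G.Adj a w) (hne : v ≠ w) (hvb : G.Reachable v b)
    (hwb : G.Reachable w b) (hdv : G.dist v b = n) (hdw : G.dist w b = n) : G.Adj v w := by
  -- Beyond `v` and `w`, the two geodesics only visit vertices at distance less than `n` from `b`,
  -- and these are too close to `b` to be adjacent to `a`.
  refine hG.adj_of_conn (S := {v, w} ∪ {u | G.Reachable u b ∧ G.dist u b < n}) hv hw hne ?_
    (Or.inl (by simp)) ?_ (((conn_of_dist hvb hdv).mono ?_).trans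
      ((conn_of_dist hwb hdw).mono ?_).symm)
  · rintro ((rfl | rfl) | h)
    · exact hv.ne rfl
    · exact hw.ne rfl
    · have := h.2; omega
  · rintro u (hu | hu) hau
    · exact hu
    · have := dist_le_of_adj hu.1 hau
      have := hu.2
      omega
  · exact Set.union_subset_union_left _ (by simp)
  · exact Set.union_subset_union_left _ (by simp)

/-- Only finitely many vertices are the first vertex of a geodesic from `a` to `b`. -/
theorem finite_geodesic {a b : V} {n : ℕ} (hab : G.dist a b = n + 1) :
    {v | G.Adj a v ∧ G.Reachable v b ∧ G.dist v b = n}.Finite := by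
  rcases Set.eq_empty_or_nonempty {v | G.Adj a v ∧ G.Reachable v b ∧ G.dist v b = n} with
    h | ⟨v, hv⟩
  · rw [h]; exact Set.finite_empty
  · refine ((Set.finite_of_encard_eq_coe (k := 2) (hG.triangle _ _ hv.1)).insert v).subset ?_
    intro w hw
    by_cases hvw : v = w
    · exact Or.inl hvw.symm
    · exact Or.inr ⟨hw.1, hG.adj_of_geodesic hab hv.1 hw.1 hvw hv.2.1 hw.2.1 hv.2.2 hw.2.2⟩

/-- All but finitely many neighbours of `a` are farther away from `b` than `a`. -/
theorem finite_not_farther {a b : V} (h : G.Reachable a b) :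
    {v | G.Adj a v ∧ G.dist v b ≠ G.dist a b + 1}.Finite := by
  obtain ⟨n, hn⟩ : ∃ n, G.dist a b = n := ⟨_, rfl⟩
  cases n with
  | zero =>
    convert! Set.finite_empty (α := V)
    rw [Set.eq_empty_iff_forall_notMem]
    rintro v ⟨hav, hv⟩
    rw [h.dist_eq_zero_iff.1 hn] at hav hv
    rw [SimpleGraph.dist_self] at hv
    exact hv (SimpleGraph.dist_eq_one_iff_adj.2 hav.symm)
  | succ n =>
    have hfin := hG.finite_geodesic hn
    refine (hfin.union (hfin.biUnion (t := fun u => {w | G.Adj a w ∧ G.Adj u w}) fun u hu =>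
      Set.finite_of_encard_eq_coe (k := 2) (hG.triangle _ _ hu.1))).subset ?_
    rintro v ⟨hav, hv⟩
    have hvb : G.Reachable v b := hav.symm.reachable.trans h
    have h1 := dist_le_of_adj hvb hav
    have h2 := dist_le_of_adj h hav.symm
    by_cases hvn : G.dist v b = n
    · exact Or.inl ⟨hav, hvb, hvn⟩
    · have hvn' : G.dist v b = n + 1 := by omega
      right
      obtain ⟨v', hvv', hv'b, hv'⟩ := exists_adj_dist hvb hvn'
      -- Either `v'` is a neighbour of `a` closer to `b`, or the walk from `v` through `v'` and `b`
      -- back to a closer neighbour `u` meets the neighbourhood of `a` only in its ends. Both ways,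
      -- `v` completes a triangle over one of the finitely many edges from `a` towards `b`.
      by_cases hav' : G.Adj a v'
      · exact Set.mem_biUnion (x := v') ⟨hav', hv'b, hv'⟩ ⟨hav, hvv'.symm⟩
      · obtain ⟨u, hau, hub, hu⟩ := exists_adj_dist h hn
        refine Set.mem_biUnion (x := u) ⟨hau, hub, hu⟩ ⟨hav, ?_⟩
        refine (hG.adj_of_conn (S := {v, u, v'} ∪ {w | G.Reachable w b ∧ G.dist w b < n})
          hav hau (by rintro rfl; omega) ?_ (Or.inl (by simp)) ?_ ?_).symm
        · rintro ((rfl | rfl | rfl) | hw)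
          · exact hav.ne rfl
          · exact hau.ne rfl
          · omega
          · have := hw.2; omega
        · rintro w ((rfl | rfl | rfl) | hw) haw
          · exact Or.inl rfl
          · exact Or.inr rfl
          · exact absurd haw hav'
          · have := dist_le_of_adj hw.1 haw
            have := hw.2
            omega
        · refine (Conn.single hvv' (Or.inl (by simp)) (Or.inl (by simp))).trans
            (((conn_of_dist hv'b hv').mono ?_).trans ((conn_of_dist hub hu).mono ?_).symm)
          · exact Set.union_subset_union_left _ (by simp)
          · exact Set.union_subset_union_left _ (by simp)

/-- There are vertices far away from any finite set. -/
theorem exists_far [Nonempty V] {F : Set V} (hF : F.Finite) (n : ℕ) :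
    ∃ v, ∀ b ∈ F, G.Reachable v b → n ≤ G.dist v b := by
  induction n with
  | zero => exact ⟨Classical.arbitrary V, fun _ _ _ => Nat.zero_le _⟩
  | succ n ih =>
    obtain ⟨v, hv⟩ := ih
    -- All but finitely many of the infinitely many neighbours of `v` are farther from every
    -- reachable member of `F` at once.
    have hfin : (⋃ b ∈ F ∩ {b | G.Reachable v b},
        {u | G.Adj v u ∧ G.dist u b ≠ G.dist v b + 1}).Finite :=
      (hF.inter_of_left _).biUnion fun b hb => hG.finite_not_farther hb.2
    obtain ⟨u, hvu, hu⟩ := ((hG.infinite_neighborSet v).sdiff hfin).nonempty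
    refine ⟨u, fun b hb hub => ?_⟩
    have hvb : G.Reachable v b := SimpleGraph.Adj.reachable hvu |>.trans hub
    have h1 := hv b hb hvb
    have h2 : G.dist u b = G.dist v b + 1 := by
      by_contra hne
      exact hu (Set.mem_biUnion (x := b) ⟨hb, hvb⟩ ⟨hvu, hne⟩)
    omega

end IsFarey

end Strong

/-! ### Partial isomorphisms, back-and-forth, and conjugates. -/

section BackAndForth

variable {V : Type*} {G : SimpleGraph V}

/-! ### Constructible finite sets -/

variable (G) in
/-- The three ways in which a constructible set may be extended by a vertex `y`: by a common
neighbour of two adjacent members, by a neighbour of a member outside of the triangle closure, or by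
a vertex not joined to any member. -/
inductive Addable (X : Set V) (y : V) : Prop
  | tri {x x' : V} : x ∈ X → x' ∈ X → G.Adj x x' → G.Adj x y → G.Adj x' y → y ∉ X → Addable X y
  | pend {x : V} : x ∈ X → G.Adj x y → y ∉ TCl G X → Addable X y
  | far : (∀ x ∈ X, ¬ Conn G Set.univ x y) → Addable X y

variable (G) in
/-- The finite sets of vertices that are obtained from the empty set by adding vertices. -/
inductive Constructible : Set V → Prop
  | empty : Constructible ∅
  | add {X : Set V} {y : V} : Constructible X → Addable G X y → Constructible (insert y X)

variable (G) in
/-- The properties of constructible sets that the back-and-forth argument relies on. -/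
structure LinkConvex (X : Set V) : Prop where
  finite : X.Finite
  conn : ∀ s ∈ X, ∀ t ∈ X, Conn G Set.univ s t → Conn G X s t
  link : ∀ a ∈ X, ∀ u ∈ X, ∀ w ∈ X, G.Adj a u → G.Adj a w →
    Conn G (G.neighborSet a) u w → Conn G (G.neighborSet a ∩ X) u w

theorem LinkConvex.strong {X : Set V} (hX : LinkConvex G X) : Strong G (TCl G X) :=
  strong_tcl fun s hs t ht h => (hX.conn s hs t ht h).mono (subset_tcl X)

/-- A further neighbour `w` of `y` in `X` would be joined to `x` within the part of `X` adjacent to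
`y`. Where this walk leaves `{x, x'}`, at `c` say, the other of these two and the next vertex are
joined through `y` in the neighbourhood of `c`. Hence, by `link`, they are also joined there inside
`X`, avoiding `y`: a circuit, contrary to `not_conn_link`. -/
theorem LinkConvex.adj_tri (hG : IsFarey G) {X : Set V} (hX : LinkConvex G X) {x x' y w : V}
    (hx : x ∈ X) (hx' : x' ∈ X) (hxx' : G.Adj x x') (hxy : G.Adj x y) (hx'y : G.Adj x' y)
    (hy : y ∉ X) (hw : w ∈ X) : G.Adj y w ↔ w = x ∨ w = x' := by
  constructor
  · intro hyw
    by_contra hne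
    have hc := hX.conn x hx w hw ((Conn.single hxy (Set.mem_univ _) (Set.mem_univ _)).trans
      (.single hyw (Set.mem_univ _) (Set.mem_univ _)))
    have hl := hG.conn_link hy hxy.symm hyw hx hc
    obtain ⟨c, d, -, ⟨hcd, hc, hd⟩, hPc, hPd⟩ :=
      reflTransGen_boundary (P := fun u => u = x ∨ u = x') hl (Or.inl rfl) hne
    have key : ∀ c' ∈ X, G.Adj c c' → G.Adj y c' → c' ≠ d → False := by
      intro c' hc' hcc' hyc' hne
      refine hG.not_conn_link hc.1.symm hcc' hcd hyc' hd.1 hne hy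
        (hX.link c hc.2 c' hc' d hd.2 hcc' hcd ?_)
      exact (Conn.single hyc'.symm hcc' hc.1.symm).trans (.single hd.1 hc.1.symm hcd)
    rcases hPc with rfl | rfl
    · exact key x' hx' hxx' hx'y.symm fun h => hPd (Or.inr h.symm)
    · exact key x hx hxx'.symm hxy.symm fun h => hPd (Or.inl h.symm)
  · rintro (rfl | rfl)
    exacts [hxy.symm, hx'y.symm]

theorem LinkConvex.adj_pend (hG : IsFarey G) {X : Set V} (hX : LinkConvex G X) {x y w : V}
    (hx : x ∈ X) (hxy : G.Adj x y) (hy : y ∉ TCl G X) (hw : w ∈ X) : G.Adj y w ↔ w = x := by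
  constructor
  · intro hyw
    exact hG.eq_of_adj_strong hX.strong hy (.base hx) (.base hw) hxy.symm hyw
  · rintro rfl
    exact hxy.symm

theorem adj_far {X : Set V} {y w : V} (hy : ∀ x ∈ X, ¬ Conn G Set.univ x y) (hw : w ∈ X) :
    ¬ G.Adj y w :=
  fun h => hy w hw (.single h.symm trivial trivial)

theorem LinkConvex.conn_insert {X : Set V} (hX : LinkConvex G X) {x y : V} (hx : x ∈ X)
    (hxy : G.Adj x y) : ∀ s ∈ insert y X, ∀ t ∈ insert y X, Conn G Set.univ s t →
      Conn G (insert y X) s t := by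
  have key : ∀ s ∈ insert y X, ∃ s' ∈ X, Conn G (insert y X) s s' := by
    rintro s (rfl | hs)
    · exact ⟨x, hx, .single hxy.symm (Or.inl rfl) (Or.inr hx)⟩
    · exact ⟨s, hs, .refl⟩
  intro s hs t ht hst
  obtain ⟨s', hs', h1⟩ := key s hs
  obtain ⟨t', ht', h2⟩ := key t ht
  exact (h1.trans ((hX.conn s' hs' t' ht' (((h1.mono (Set.subset_univ _)).symm.trans hst).trans
    (h2.mono (Set.subset_univ _)))).mono (Set.subset_insert _ _))).trans h2.symm

/-- A vertex added over a triangle attaches, in the neighbourhood of each end of the old edge, to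
the other end. A pendant vertex cannot be joined to `X` in a neighbourhood, since rolling over
triangles would place it in `TCl G X`. A far vertex is adjacent to nothing in `X`. -/
theorem LinkConvex.insert (hG : IsFarey G) {X : Set V} (hX : LinkConvex G X) {y : V}
    (h : Addable G X y) : LinkConvex G (insert y X) := by
  have hsub : ∀ a, G.neighborSet a ∩ X ⊆ G.neighborSet a ∩ Insert.insert y X := fun a =>
    Set.inter_subset_inter_right _ (Set.subset_insert _ _)
  cases h with
  | @tri x x' hx hx' hxx' hxy hx'y hy =>
    have hadj : ∀ {w}, w ∈ X → (G.Adj y w ↔ w = x ∨ w = x') :=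
      hX.adj_tri hG hx hx' hxx' hxy hx'y hy
    refine ⟨hX.finite.insert y, hX.conn_insert hx hxy, ?_⟩
    rintro a (rfl | ha) u hu w hw hau haw hc
    · have hu' := hu.resolve_left hau.ne'
      have hw' := hw.resolve_left haw.ne'
      have h1 := (hadj hu').1 hau
      have h2 := (hadj hw').1 haw
      by_cases huw : u = w
      · rw [huw]; exact .refl
      · refine .single ?_ ⟨hau, hu⟩ ⟨haw, hw⟩
        rcases h1 with rfl | rfl <;> rcases h2 with rfl | rfl
        exacts [absurd rfl huw, hxx', hxx'.symm, absurd rfl huw]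
    · have key : ∀ u ∈ Insert.insert y X, G.Adj a u → ∃ u' ∈ X, G.Adj a u' ∧
          Conn G (G.neighborSet a ∩ Insert.insert y X) u u' := by
        rintro u (rfl | hu) hau
        · rcases (hadj ha).1 hau.symm with rfl | rfl
          · exact ⟨x', hx', hxx', .single hx'y.symm ⟨hau, Or.inl rfl⟩ ⟨hxx', Or.inr hx'⟩⟩
          · exact ⟨x, hx, hxx'.symm, .single hxy.symm ⟨hau, Or.inl rfl⟩ ⟨hxx'.symm, Or.inr hx⟩⟩
        · exact ⟨u, hu, hau, .refl⟩
      obtain ⟨u', hu', hau', h1⟩ := key u hu hau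
      obtain ⟨w', hw', haw', h2⟩ := key w hw haw
      refine (h1.trans ((hX.link a ha u' hu' w' hw' hau' haw' ?_).mono (hsub a))).trans h2.symm
      exact ((h1.mono Set.inter_subset_left).symm.trans hc).trans (h2.mono Set.inter_subset_left)
  | @pend x hx hxy hy =>
    have hadj : ∀ {w}, w ∈ X → (G.Adj y w ↔ w = x) := hX.adj_pend hG hx hxy hy
    refine ⟨hX.finite.insert y, hX.conn_insert hx hxy, ?_⟩
    rintro a (rfl | ha) u hu w hw hau haw hc
    · have h1 := (hadj (hu.resolve_left hau.ne')).1 hau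
      have h2 := (hadj (hw.resolve_left haw.ne')).1 haw
      rw [h1, h2]
      exact .refl
    · have key : ∀ w ∈ X, G.Adj a w → ¬ Conn G (G.neighborSet a) w y := by
        intro w hw haw hc
        refine hy (?_ : y ∈ TCl G X)
        clear * - hc hw ha
        induction hc with
        | refl => exact .base hw
        | tail _ h ih => exact TCl.step (.base ha) ih h.2.1 h.2.2 h.1
      rcases hu with rfl | hu <;> rcases hw with rfl | hw
      · exact .refl
      · exact absurd hc.symm (key w hw haw)
      · exact absurd hc (key u hu hau)
      · exact (hX.link a ha u hu w hw hau haw hc).mono (hsub a)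
  | far hy =>
    refine ⟨hX.finite.insert y, ?_, ?_⟩
    · rintro s (rfl | hs) t (rfl | ht) hst
      · exact .refl
      · exact absurd hst.symm (hy t ht)
      · exact absurd hst (hy s hs)
      · exact (hX.conn s hs t ht hst).mono (Set.subset_insert _ _)
    · rintro a (rfl | ha) u hu w hw hau haw hc
      · exact absurd hau (adj_far hy (hu.resolve_left hau.ne'))
      · have key : ∀ u ∈ Insert.insert y X, G.Adj a u → u ∈ X := by
          rintro u (rfl | hu) hau
          · exact absurd hau.symm (adj_far hy ha)
          · exact hu
        exact (hX.link a ha u (key u hu hau) w (key w hw haw) hau haw hc).mono (hsub a)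

theorem Constructible.linkConvex (hG : IsFarey G) {X : Set V} (hX : Constructible G X) :
    LinkConvex G X := by
  induction hX with
  | empty => exact ⟨Set.finite_empty, by simp, by simp⟩
  | add _ h ih => exact ih.insert hG h

/-- Follow a walk inside `S` to `v`: a next vertex in the triangle closure is added through its
derivation, any other as a pendant vertex. The predicate is abstract so that the argument serves
both constructible sets and domains of partial isomorphisms. -/
theorem exists_extension {Φ : Set V → Prop} {S : Set V} (hS : Strong G S)
    (hΦ : ∀ Y y, Y ⊆ S → Φ Y → y ∈ S → Addable G Y y → Φ (insert y Y)) {X : Set V} (hX : Φ X)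
    (hXS : X ⊆ S) {v : V} (hv : v ∈ S) : ∃ Y, X ⊆ Y ∧ Y ⊆ S ∧ Φ Y ∧ v ∈ Y := by
  have hadd : ∀ Y y, Y ⊆ S → Φ Y → y ∈ S → Addable G Y y → ∃ Y', Y ⊆ Y' ∧ Y' ⊆ S ∧ Φ Y' ∧ y ∈ Y' :=
    fun Y y hY hΦY hy h => ⟨_, Set.subset_insert _ _, Set.insert_subset hy hY,
      hΦ Y y hY hΦY hy h, Or.inl rfl⟩
  have htcl : ∀ X, ∀ z ∈ TCl G X, ∀ Y, X ⊆ Y → Y ⊆ S → Φ Y →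
      ∃ Y', Y ⊆ Y' ∧ Y' ⊆ S ∧ Φ Y' ∧ z ∈ Y' := by
    intro X z hz
    induction hz with
    | base h => exact fun Y hXY hYS hY => ⟨Y, subset_rfl, hYS, hY, hXY h⟩
    | @step x y z _ _ hxy hxz hyz ih1 ih2 =>
      intro Y hXY hYS hY
      obtain ⟨Y1, h1, hYS1, hY1, hx⟩ := ih1 Y hXY hYS hY
      obtain ⟨Y2, h2, hYS2, hY2, hy⟩ := ih2 Y1 (hXY.trans h1) hYS1 hY1
      have hx2 := h2 hx
      by_cases hz : z ∈ Y2
      · exact ⟨Y2, h1.trans h2, hYS2, hY2, hz⟩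
      · obtain ⟨Y3, h3, h⟩ := hadd Y2 z hYS2 hY2 (hS.tri (hYS2 hx2) (hYS2 hy) hxy hxz hyz)
          (.tri hx2 hy hxy hxz hyz hz)
        exact ⟨Y3, (h1.trans h2).trans h3, h⟩
  by_cases hfar : ∀ x ∈ X, ¬ Conn G Set.univ x v
  · exact hadd X v hXS hX hv (.far hfar)
  · push Not at hfar
    obtain ⟨x, hx, hxv⟩ := hfar
    have hc := hS.conn x (hXS hx) v hv hxv
    clear hxv hv
    induction hc with
    | refl => exact ⟨X, subset_rfl, hXS, hX, hx⟩
    | @tail u v _ h ih =>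
      obtain ⟨Y, hXY, hYS, hY, hu⟩ := ih
      by_cases hvY : v ∈ TCl G Y
      · obtain ⟨Y', h', h''⟩ := htcl Y v hvY Y subset_rfl hYS hY
        exact ⟨Y', hXY.trans h', h''⟩
      · obtain ⟨Y', h', h''⟩ := hadd Y v hYS hY h.2.2 (.pend hu h.1 hvY)
        exact ⟨Y', hXY.trans h', h''⟩

/-- Inside a strong set, any finite subset can be added to a constructible set. -/
theorem Constructible.exists_superset {S : Set V} (hS : Strong G S) {X A : Set V}
    (hX : Constructible G X) (hXS : X ⊆ S) (hA : A.Finite) (hAS : A ⊆ S) :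
    ∃ Y, X ⊆ Y ∧ A ⊆ Y ∧ Y ⊆ S ∧ Constructible G Y := by
  induction A, hA using Set.Finite.induction_on with
  | empty => exact ⟨X, subset_rfl, Set.empty_subset _, hXS, hX⟩
  | @insert a A _ _ ih =>
    obtain ⟨Y, hXY, hAY, hYS, hY⟩ := ih ((Set.subset_insert _ _).trans hAS)
    obtain ⟨Z, hYZ, hZS, hZ, ha⟩ := exists_extension hS (fun Y y _ hY _ h => hY.add h) hY hYS
      (hAS (Or.inl rfl))
    exact ⟨Z, hXY.trans hYZ, Set.insert_subset ha (hAY.trans hYZ), hZS, hZ⟩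

/-! ### The back-and-forth system -/

variable (G) in
/-- The finite partial isomorphisms that are obtained by adding vertices in the same way on both
sides. -/
inductive PIso : Set (V × V) → Prop
  | empty : PIso ∅
  | tri {p : Set (V × V)} {x x' y y' z z' : V} : PIso p → (x, x') ∈ p → (y, y') ∈ p →
      G.Adj x y → G.Adj x z → G.Adj y z → z ∉ Prod.fst '' p →
      G.Adj x' y' → G.Adj x' z' → G.Adj y' z' → z' ∉ Prod.snd '' p → PIso (insert (z, z') p)
  | pend {p : Set (V × V)} {x x' y y' : V} : PIso p → (x, x') ∈ p →
      G.Adj x y → y ∉ TCl G (Prod.fst '' p) →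
      G.Adj x' y' → y' ∉ TCl G (Prod.snd '' p) → PIso (insert (y, y') p)
  | far {p : Set (V × V)} {y y' : V} : PIso p →
      (∀ x ∈ Prod.fst '' p, ¬ Conn G Set.univ x y) →
      (∀ x ∈ Prod.snd '' p, ¬ Conn G Set.univ x y') → PIso (insert (y, y') p)

theorem PIso.swap {p : Set (V × V)} (h : PIso G p) : PIso G (Prod.swap '' p) := by
  have h1 : ∀ p : Set (V × V), Prod.fst '' (Prod.swap '' p) = Prod.snd '' p := fun p => by
    rw [← Set.image_comp]; rfl
  have h2 : ∀ p : Set (V × V), Prod.snd '' (Prod.swap '' p) = Prod.fst '' p := fun p => by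
    rw [← Set.image_comp]; rfl
  induction h with
  | empty => rw [Set.image_empty]; exact .empty
  | tri _ hx hy h3 h4 h5 h6 h7 h8 h9 h10 ih =>
    rw [Set.image_insert_eq]
    exact .tri ih ⟨_, hx, rfl⟩ ⟨_, hy, rfl⟩ h7 h8 h9 (by rwa [h1]) h3 h4 h5 (by rwa [h2])
  | pend _ hx h3 h4 h5 h6 ih =>
    rw [Set.image_insert_eq]
    exact .pend ih ⟨_, hx, rfl⟩ h5 (by rwa [h1]) h3 (by rwa [h2])
  | far _ h3 h4 ih =>
    rw [Set.image_insert_eq]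
    exact .far ih (by rwa [h1]) (by rwa [h2])

theorem PIso.constructible_fst {p : Set (V × V)} (h : PIso G p) :
    Constructible G (Prod.fst '' p) := by
  induction h with
  | empty => rw [Set.image_empty]; exact .empty
  | tri _ hx hy h3 h4 h5 h6 _ _ _ _ ih =>
    rw [Set.image_insert_eq]
    exact .add ih (.tri ⟨_, hx, rfl⟩ ⟨_, hy, rfl⟩ h3 h4 h5 h6)
  | pend _ hx h3 h4 _ _ ih =>
    rw [Set.image_insert_eq]
    exact .add ih (.pend ⟨_, hx, rfl⟩ h3 h4)
  | far _ h3 _ ih =>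
    rw [Set.image_insert_eq]
    exact .add ih (.far h3)

theorem PIso.constructible_snd {p : Set (V × V)} (h : PIso G p) :
    Constructible G (Prod.snd '' p) := by
  have := h.swap.constructible_fst
  rw [← Set.image_comp] at this
  exact this

theorem Constructible.pIso_diag {X : Set V} (h : Constructible G X) :
    PIso G ((fun x => (x, x)) '' X) := by
  have h1 : ∀ X : Set V, Prod.fst '' ((fun x => (x, x)) '' X) = X := fun X => by
    rw [← Set.image_comp]; exact Set.image_id X
  have h2 : ∀ X : Set V, Prod.snd '' ((fun x => (x, x)) '' X) = X := fun X => by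
    rw [← Set.image_comp]; exact Set.image_id X
  induction h with
  | empty => rw [Set.image_empty]; exact .empty
  | add _ h ih =>
    rw [Set.image_insert_eq]
    cases h with
    | tri hx hy h3 h4 h5 h6 =>
      exact .tri ih ⟨_, hx, rfl⟩ ⟨_, hy, rfl⟩ h3 h4 h5 (by rwa [h1]) h3 h4 h5 (by rwa [h2])
    | pend hx h3 h4 => exact .pend ih ⟨_, hx, rfl⟩ h3 (by rwa [h1]) h3 (by rwa [h2])
    | far h3 => exact .far ih (by rwa [h1]) (by rwa [h2])

variable (G) in
/-- The pairs in `p` form a partial isomorphism. -/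
def IsPartialIso (p : Set (V × V)) : Prop :=
  ∀ q ∈ p, ∀ r ∈ p, (q.1 = r.1 ↔ q.2 = r.2) ∧ (G.Adj q.1 r.1 ↔ G.Adj q.2 r.2)

theorem IsPartialIso.insert {p : Set (V × V)} (h : IsPartialIso G p) {z z' : V}
    (hz : z ∉ Prod.fst '' p) (hz' : z' ∉ Prod.snd '' p)
    (hadj : ∀ q ∈ p, G.Adj z q.1 ↔ G.Adj z' q.2) : IsPartialIso G (insert (z, z') p) := by
  rintro q (rfl | hq) r (rfl | hr)
  · simp
  · refine ⟨⟨?_, ?_⟩, hadj r hr⟩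
    · rintro rfl; exact absurd ⟨r, hr, rfl⟩ hz
    · rintro rfl; exact absurd ⟨r, hr, rfl⟩ hz'
  · refine ⟨⟨?_, ?_⟩, by rw [G.adj_comm, hadj q hq, G.adj_comm]⟩
    · rintro rfl; exact absurd ⟨q, hq, rfl⟩ hz
    · rintro rfl; exact absurd ⟨q, hq, rfl⟩ hz'
  · exact h q hq r hr

theorem PIso.isPartialIso (hG : IsFarey G) {p : Set (V × V)} (h : PIso G p) :
    IsPartialIso G p := by
  induction h with
  | empty => simp [IsPartialIso]
  | @tri p x x' y y' z z' hp hx hy h1 h2 h3 h4 h5 h6 h7 h8 ih =>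
    have l1 := hp.constructible_fst.linkConvex hG
    have l2 := hp.constructible_snd.linkConvex hG
    refine ih.insert h4 h8 fun q hq => ?_
    rw [l1.adj_tri hG ⟨_, hx, rfl⟩ ⟨_, hy, rfl⟩ h1 h2 h3 h4 ⟨q, hq, rfl⟩,
      l2.adj_tri hG ⟨_, hx, rfl⟩ ⟨_, hy, rfl⟩ h5 h6 h7 h8 ⟨q, hq, rfl⟩,
      (ih q hq _ hx).1, (ih q hq _ hy).1]
  | @pend p x x' y y' hp hx h1 h2 h3 h4 ih =>
    have l1 := hp.constructible_fst.linkConvex hG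
    have l2 := hp.constructible_snd.linkConvex hG
    refine ih.insert (fun h => h2 (.base h)) (fun h => h4 (.base h)) fun q hq => ?_
    rw [l1.adj_pend hG ⟨_, hx, rfl⟩ h1 h2 ⟨q, hq, rfl⟩,
      l2.adj_pend hG ⟨_, hx, rfl⟩ h3 h4 ⟨q, hq, rfl⟩, (ih q hq _ hx).1]
  | @far p y y' hp h1 h2 ih =>
    refine ih.insert (fun h => h1 _ h .refl) (fun h => h2 _ h .refl) fun q hq => ?_
    exact iff_of_false (adj_far h1 ⟨q, hq, rfl⟩) (adj_far h2 ⟨q, hq, rfl⟩)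

variable (G) in
/-- The properties of sufficiently saturated models that the back-and-forth argument uses. -/
structure Rich (G : SimpleGraph V) : Prop extends IsFarey G where
  many : ∀ (x : V) (C : Set V), C.Countable → ∃ y, y ∉ C ∧ G.Adj x y
  far : ∀ X : Set V, X.Finite → ∃ y, ∀ x ∈ X, ¬ Conn G Set.univ x y

theorem PIso.exists_insert (hG : Rich G) {p : Set (V × V)} (hp : PIso G p) {y : V}
    (h : Addable G (Prod.fst '' p) y) : ∃ y', PIso G (insert (y, y') p) := by
  have hiso := hp.isPartialIso hG.toIsFarey
  have hfin := (hp.constructible_snd.linkConvex hG.toIsFarey).finite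
  cases h with
  | @tri x₁ x₂ hx hy h1 h2 h3 h4 =>
    obtain ⟨⟨x, x'⟩, hx, rfl⟩ := hx
    obtain ⟨⟨z, z'⟩, hz, rfl⟩ := hy
    have h1' : G.Adj x' z' := (hiso _ hx _ hz).2.1 h1
    obtain ⟨a', b', hab', hw'⟩ := hG.exists_triangle h1'
    have ha' := (hw' a').2 (Or.inl rfl)
    have hb' := (hw' b').2 (Or.inr rfl)
    by_cases ha : a' ∈ Prod.snd '' p
    · by_cases hb : b' ∈ Prod.snd '' p
      · exfalso
        obtain ⟨⟨a, _⟩, ha, rfl⟩ := ha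
        obtain ⟨⟨b, _⟩, hb, rfl⟩ := hb
        obtain ⟨c, d, hcd, hw⟩ := hG.exists_triangle h1
        have e1 := (hw a).1 ⟨(hiso _ hx _ ha).2.2 ha'.1, (hiso _ hz _ ha).2.2 ha'.2⟩
        have e2 := (hw b).1 ⟨(hiso _ hx _ hb).2.2 hb'.1, (hiso _ hz _ hb).2.2 hb'.2⟩
        have e3 := (hw y).1 ⟨h2, h3⟩
        have hne : a ≠ b := fun e => hab' ((hiso _ ha _ hb).1.1 e)
        have hay : a ≠ y := fun e => h4 ⟨_, ha, e⟩
        have hby : b ≠ y := fun e => h4 ⟨_, hb, e⟩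
        rcases e1 with rfl | rfl <;> rcases e2 with rfl | rfl <;> rcases e3 with rfl | rfl <;>
          simp_all
      · exact ⟨b', .tri hp hx hz h1 h2 h3 h4 h1' hb'.1 hb'.2 hb⟩
    · exact ⟨a', .tri hp hx hz h1 h2 h3 h4 h1' ha'.1 ha'.2 ha⟩
  | pend hx h1 h2 =>
    obtain ⟨⟨x, x'⟩, hx, rfl⟩ := hx
    obtain ⟨y', hy', hadj⟩ := hG.many x' _ (countable_tcl hG.toIsFarey hfin.countable)
    exact ⟨y', .pend hp hx h1 h2 hadj hy'⟩
  | far h1 =>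
    obtain ⟨y', hy'⟩ := hG.far _ hfin
    exact ⟨y', .far hp h1 hy'⟩

theorem PIso.forth (hG : Rich G) {p : Set (V × V)} (hp : PIso G p) (v : V) :
    ∃ q, p ⊆ q ∧ PIso G q ∧ ∃ v', (v, v') ∈ q := by
  obtain ⟨Y, -, -, ⟨q, hpq, hq, rfl⟩, ⟨⟨_, v'⟩, hv, rfl⟩⟩ :=
    exists_extension (Φ := fun Y => ∃ q, p ⊆ q ∧ PIso G q ∧ Prod.fst '' q = Y) (strong_univ (G := G))
    (by
      rintro _ y - ⟨q, hpq, hq, rfl⟩ - h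
      obtain ⟨y', hy'⟩ := hq.exists_insert hG h
      exact ⟨_, hpq.trans (Set.subset_insert _ _), hy', Set.image_insert_eq⟩)
    ⟨p, subset_rfl, hp, rfl⟩ (Set.subset_univ _) (Set.mem_univ v)
  exact ⟨q, hpq, hq, v', hv⟩

theorem PIso.back (hG : Rich G) {p : Set (V × V)} (hp : PIso G p) (v' : V) :
    ∃ q, p ⊆ q ∧ PIso G q ∧ ∃ v, (v, v') ∈ q := by
  obtain ⟨q, hpq, hq, v, hv⟩ := hp.swap.forth hG v'
  refine ⟨Prod.swap '' q, fun r hr => ⟨r.swap, hpq ⟨r, hr, rfl⟩, Prod.swap_swap r⟩, hq.swap, v,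
    ⟨_, hv, rfl⟩⟩

/-- The partial isomorphisms of the back-and-forth system preserve all formulas. -/
theorem PIso.realize_iff [Language.graph.Structure V] (hG : Rich G)
    (hadj : ∀ x y : V, Structure.RelMap adj ![x, y] ↔ G.Adj x y) {α : Type*} {n : ℕ}
    (φ : Language.graph.BoundedFormula α n) {p : Set (V × V)} (hp : PIso G p) {v w : α → V}
    {xs ys : Fin n → V} (hv : ∀ i, (v i, w i) ∈ p) (hx : ∀ i, (xs i, ys i) ∈ p) :
    φ.Realize v xs ↔ φ.Realize w ys := by
  have hterm : ∀ {n : ℕ} (t : Language.graph.Term (α ⊕ Fin n)) {p : Set (V × V)} {xs ys : Fin n → V},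
      (∀ i, (v i, w i) ∈ p) → (∀ i, (xs i, ys i) ∈ p) →
      (t.realize (Sum.elim v xs), t.realize (Sum.elim w ys)) ∈ p := by
    intro n t p xs ys hv hx
    cases t with
    | var i =>
      cases i with
      | inl i => exact hv i
      | inr i => exact hx i
    | func f _ => exact isEmptyElim f
  induction φ generalizing p with
  | falsum => rfl
  | equal t₁ t₂ =>
    exact (hp.isPartialIso hG.toIsFarey _ (hterm t₁ hv hx) _ (hterm t₂ hv hx)).1
  | @rel n l R ts =>
    cases R
    have key : ∀ f : Fin 2 → V, Structure.RelMap (L := Language.graph) graphRel.adj f ↔ G.Adj (f 0) (f 1) := fun f => by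
      rw [← hadj]
      exact iff_of_eq (congrArg _ (by ext i; fin_cases i <;> rfl))
    have := (hp.isPartialIso hG.toIsFarey _ (hterm (ts 0) hv hx) _ (hterm (ts 1) hv hx)).2
    exact (key fun i => (ts i).realize (Sum.elim v xs)).trans
      (this.trans (key fun i => (ts i).realize (Sum.elim w ys)).symm)
  | imp _ _ ih1 ih2 => exact imp_congr (ih1 hp hv hx) (ih2 hp hv hx)
  | all φ ih =>
    have hsnoc : ∀ {q : Set (V × V)} {a b : V}, p ⊆ q → (a, b) ∈ q →
        ∀ i, ((Fin.snoc xs a : Fin _ → V) i, (Fin.snoc ys b : Fin _ → V) i) ∈ q := by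
      intro q a b hpq hab i
      refine Fin.lastCases ?_ (fun i => ?_) i
      · simpa using hab
      · simpa using hpq (hx i)
    simp only [BoundedFormula.Realize]
    constructor
    · intro h b
      obtain ⟨q, hpq, hq, a, hab⟩ := hp.back hG b
      exact (ih hq (fun i => hpq (hv i)) (hsnoc hpq hab)).1 (h a)
    · intro h a
      obtain ⟨q, hpq, hq, b, hab⟩ := hp.forth hG a
      exact (ih hq (fun i => hpq (hv i)) (hsnoc hpq hab)).2 (h b)

theorem exists_last_exit {S : Set V} {s b : V} (h : Conn G Set.univ s b) (hs : s ∈ S)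
    (hb : b ∉ S) : ∃ t ∈ S, ∃ c ∉ S, G.Adj t c ∧ Conn G Sᶜ c b := by
  induction h with
  | refl => exact absurd hs hb
  | @tail b d _ hbd ih =>
    by_cases hbS : b ∈ S
    · exact ⟨b, hbS, d, hb, hbd.1, .refl⟩
    · obtain ⟨t, ht, c, hc, htc, hcb⟩ := ih hbS
      exact ⟨t, ht, c, hc, htc, hcb.trans (.single hbd.1 hbS hb)⟩

/-- A vertex outside of a strong set `S` has infinitely many conjugates over any finite subset
of `S`. -/
theorem Rich.exists_conjugate (hG : Rich G) {S A B : Set V} (hS : Strong G S) (hA : A.Finite)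
    (hAS : A ⊆ S) {b : V} (hb : b ∉ S) (hB : B.Finite) :
    ∃ b' ∉ B, ∃ p, PIso G p ∧ (∀ a ∈ A, (a, a) ∈ p) ∧ (b, b') ∈ p := by
  have hfst : ∀ X : Set V, Prod.fst '' ((fun x => (x, x)) '' X) = X := fun X => by
    rw [← Set.image_comp]; exact Set.image_id X
  have hsnd : ∀ X : Set V, Prod.snd '' ((fun x => (x, x)) '' X) = X := fun X => by
    rw [← Set.image_comp]; exact Set.image_id X
  by_cases hfar : ∀ s ∈ S, ¬ Conn G Set.univ s b
  · obtain ⟨X, -, hAX, hXS, hX⟩ := Constructible.exists_superset hS .empty (Set.empty_subset _) hA hAS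
    obtain ⟨b', hb'⟩ := hG.far (X ∪ B) ((hX.linkConvex hG.toIsFarey).finite.union hB)
    refine ⟨b', fun h => hb' b' (Or.inr h) .refl, _, .far hX.pIso_diag (y := b) (y' := b') ?_ ?_,
      fun a ha => Or.inr ⟨a, hAX ha, rfl⟩, Or.inl rfl⟩
    · rw [hfst]; exact fun x hx => hfar x (hXS hx)
    · rw [hsnd]; exact fun x hx => hb' x (Or.inl hx)
  · push Not at hfar
    obtain ⟨s₀, hs₀, hs₀b⟩ := hfar
    obtain ⟨s, hs, c, hc, hsc, hcb⟩ := exists_last_exit hs₀b hs₀ hb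
    obtain ⟨X, -, hAX, hXS, hX⟩ := Constructible.exists_superset hS .empty (Set.empty_subset _)
      (hA.insert s) (Set.insert_subset hs hAS)
    obtain ⟨Z, hXZ, hBZ, -, hZ⟩ := Constructible.exists_superset strong_univ hX (Set.subset_univ _)
      hB (Set.subset_univ _)
    have hZl := hZ.linkConvex hG.toIsFarey
    obtain ⟨c', hc', hsc'⟩ := hG.many s _ (countable_tcl hG.toIsFarey hZl.finite.countable)
    have hsX : s ∈ X := hAX (Or.inl rfl)
    have hp₀ : PIso G (insert (c, c') ((fun x => (x, x)) '' X)) := by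
      refine .pend hX.pIso_diag ⟨s, hsX, rfl⟩ hsc ?_ hsc' ?_
      · rw [hfst]; exact fun h => hc (tcl_subset hS.tri hXS h)
      · rw [hsnd]; exact fun h => hc' (tcl_mono hXZ h)
    -- The walk from `c` to `b` is copied vertex by vertex, starting at `c'` outside `TCl G Z`. If
    -- the copy entered this strong set, it would do so at `s` by `eq_of_strong`; but `s`
    -- corresponds to itself, whereas the original walk avoids `S`. So the copy of `b` misses `B`.
    have key : ∃ b', b' ∉ TCl G Z ∧
        Relation.ReflTransGen (fun a b => G.Adj a b ∧ ¬ (a ∈ TCl G Z ∧ b ∈ TCl G Z)) s b' ∧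
        ∃ p, insert (c, c') ((fun x => (x, x)) '' X) ⊆ p ∧ PIso G p ∧ (b, b') ∈ p := by
      clear hs₀b hb
      induction hcb with
      | refl => exact ⟨c', hc', .single ⟨hsc', fun h => hc' h.2⟩, _, subset_rfl, hp₀, Or.inl rfl⟩
      | @tail u v _ huv ih =>
        obtain ⟨u', hu', hsu', p, hp₀p, hp, hup⟩ := ih
        obtain ⟨q, hpq, hq, v', hvq⟩ := hp.forth hG v
        have hiso := hq.isPartialIso hG.toIsFarey
        have huv' : G.Adj u' v' := (hiso _ (hpq hup) _ hvq).2.1 huv.1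
        have hsv' := hsu'.tail (c := v') ⟨huv', fun h => hu' h.1⟩
        refine ⟨v', fun hv' => ?_, hsv', q, hp₀p.trans hpq, hq, hvq⟩
        have e : s = v' := hG.toIsFarey.eq_of_strong hZl.strong (.base (hXZ hsX)) hv' hsv'
        have : s = v := (hiso (s, s) (hpq (hp₀p (Or.inr ⟨s, hsX, rfl⟩))) _ hvq).1.2 e
        exact huv.2.2 (this ▸ hs)
    obtain ⟨b', hb', -, p, hp₀p, hp, hbp⟩ := key
    exact ⟨b', fun h => hb' (.base (hBZ h)), p, hp,
      fun a ha => hp₀p (Or.inr ⟨a, hAX (Or.inr ha), rfl⟩), hbp⟩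

end BackAndForth

/-! ### Edge classes and convexity in the bipartite graph. -/

section Hull

variable {V : Type*} {G : SimpleGraph V}

/-! ### Classes of edges -/

variable (G) in
/-- The class of an edge. -/
def edgeClass {u v : V} (h : G.Adj u v) : EdgeClass G :=
  Quotient.mk (edgeSetoid G) ⟨s(u, v), h⟩

theorem exists_edgeClass (E : EdgeClass G) : ∃ (u v : V) (h : G.Adj u v), E = edgeClass G h := by
  induction E using Quotient.ind with
  | _ e =>
    obtain ⟨e, he⟩ := e
    induction e using Sym2.ind with
    | _ u v => exact ⟨u, v, he, rfl⟩

theorem generated_iff {u v x : V} : Generated G s(u, v) x ↔ x ∈ TCl G {u, v} := by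
  constructor
  · intro h
    induction h with
    | base h => exact .base (Sym2.mem_iff.1 h)
    | step _ _ h1 h2 h3 ih1 ih2 => exact TCl.step ih1 ih2 h1 h2 h3
  · intro h
    induction h with
    | base h => exact .base (Sym2.mem_iff.2 h)
    | step _ _ h1 h2 h3 ih1 ih2 => exact Generated.step ih1 ih2 h1 h2 h3

theorem edgeClass_eq_iff {u v u' v' : V} (h : G.Adj u v) (h' : G.Adj u' v') :
    edgeClass G h = edgeClass G h' ↔ TCl G {u, v} = TCl G {u', v'} := by
  have hv : ∀ u v : V, {x | Generated G s(u, v) x} = TCl G {u, v} := fun u v =>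
    Set.ext fun x => generated_iff
  rw [edgeClass, edgeClass, Quotient.eq, ← hv, ← hv]
  constructor
  · exact fun h => congrArg SimpleGraph.Subgraph.verts h
  · intro h
    change generatedFarey G _ = generatedFarey G _
    rw [generatedFarey, generatedFarey, h]

namespace IsFarey

variable (hG : IsFarey G)
include hG

/-- Every generated vertex has a neighbour that is also generated, and the edge between them
generates the same set. -/
theorem verts_edgeClass {u v : V} (h : G.Adj u v) :
    (edgeClass G h).verts = TCl G {u, v} := by
  ext x
  constructor
  · rintro ⟨⟨e, he⟩, hE, hx⟩
    induction e using Sym2.ind with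
    | _ a b =>
      rw [← (edgeClass_eq_iff (G.mem_edgeSet.1 he) h).1 hE]
      exact .base (Sym2.mem_iff.1 hx)
  · intro hx
    have hstr := strong_tcl_edge h
    have key : ∃ y ∈ TCl G {u, v}, G.Adj x y := by
      obtain ⟨z, hz, hzx⟩ := exists_conn_of_mem_tcl hx
      rcases Relation.ReflTransGen.cases_tail hzx with rfl | ⟨y, -, hyx, hy, -⟩
      · rcases hz with rfl | rfl
        · exact ⟨v, .base (by simp), h⟩
        · exact ⟨u, .base (by simp), h.symm⟩
      · exact ⟨y, hy, hyx.symm⟩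
    obtain ⟨y, hy, hxy⟩ := key
    refine ⟨⟨s(x, y), hxy⟩, ?_, Sym2.mem_mk_left x y⟩
    exact (edgeClass_eq_iff hxy h).2 (hG.tcl_eq_of_adj h hxy hx hy)

theorem edgeClass_eq {E : EdgeClass G} {a b : V} (hab : G.Adj a b) (ha : a ∈ E.verts)
    (hb : b ∈ E.verts) : edgeClass G hab = E := by
  obtain ⟨u, v, h, rfl⟩ := exists_edgeClass E
  rw [hG.verts_edgeClass] at ha hb
  exact (edgeClass_eq_iff hab h).2 (hG.tcl_eq_of_adj h hab ha hb)

theorem left_mem_verts {a b : V} (hab : G.Adj a b) : a ∈ (edgeClass G hab).verts := by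
  rw [hG.verts_edgeClass]; exact .base (by simp)

theorem right_mem_verts {a b : V} (hab : G.Adj a b) : b ∈ (edgeClass G hab).verts := by
  rw [hG.verts_edgeClass]; exact .base (by simp)

theorem strong_verts (E : EdgeClass G) : Strong G E.verts := by
  obtain ⟨u, v, h, rfl⟩ := exists_edgeClass E
  rw [hG.verts_edgeClass]
  exact strong_tcl_edge h

theorem conn_verts {E : EdgeClass G} {x y : V} (hx : x ∈ E.verts) (hy : y ∈ E.verts) :
    Conn G E.verts x y := by
  obtain ⟨u, v, h, rfl⟩ := exists_edgeClass E
  rw [hG.verts_edgeClass] at hx hy ⊢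
  have hu : u ∈ TCl G {u, v} := .base (by simp)
  have hv : v ∈ TCl G {u, v} := .base (by simp)
  have key : ∀ z ∈ TCl G {u, v}, Conn G (TCl G {u, v}) u z := by
    intro z hz
    obtain ⟨w, hw, hwz⟩ := exists_conn_of_mem_tcl hz
    rcases hw with rfl | rfl
    · exact hwz
    · exact (Conn.single h hu hv).trans hwz
  exact (key x hx).symm.trans (key y hy)

end IsFarey

/-! ### Walks in the bipartite graph -/

/-- The vertices that a node of the bipartite graph stands for. -/
def nodeVerts : V ⊕ EdgeClass G → Set V
  | Sum.inl x => {x}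
  | Sum.inr E => E.verts

/-- A visit to a class is replaced by a walk inside its Farey graph, all of whose edges belong to
that class. -/
theorem IsFarey.reflTransGen_of_treeGraph (hG : IsFarey G) {N : Set (V ⊕ EdgeClass G)}
    {w w' : V ⊕ EdgeClass G} (hw : w ∈ N) (h : Conn (treeGraph G) N w w') :
    ∀ x ∈ nodeVerts w, ∀ y ∈ nodeVerts w',
      Relation.ReflTransGen (fun a b => ∃ hab : G.Adj a b, Sum.inr (edgeClass G hab) ∈ N) x y := by
  have hE : ∀ E : EdgeClass G, Sum.inr E ∈ N → ∀ x ∈ E.verts, ∀ y ∈ E.verts,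
      Relation.ReflTransGen (fun a b => ∃ hab : G.Adj a b, Sum.inr (edgeClass G hab) ∈ N) x y := by
    intro E hEN x hx y hy
    refine reflTransGen_mono ?_ (hG.conn_verts hx hy)
    rintro a b ⟨hab, ha, hb⟩
    exact ⟨hab, by rwa [hG.edgeClass_eq hab ha hb]⟩
  intro x hx
  induction h with
  | refl =>
    intro y hy
    cases w with
    | inl z => rw [Set.mem_singleton_iff.1 hx, Set.mem_singleton_iff.1 hy]
    | inr E => exact hE E hw x hx y hy
  | @tail b c _ hbc ih =>
    intro y hy
    obtain ⟨hadj, hb, hc⟩ := hbc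
    cases b with
    | inl z =>
      cases c with
      | inl z' => exact hadj.elim
      | inr E => exact (ih z rfl).trans (hE E hc z hadj y hy)
    | inr E =>
      cases c with
      | inl z =>
        rw [Set.mem_singleton_iff.1 hy]
        exact ih z hadj
      | inr E' => exact hadj.elim

theorem conn_of_walk {W : Type*} {H : SimpleGraph W} {N : Set W} {u v : W} (p : H.Walk u v)
    (hp : ∀ w ∈ p.support, w ∈ N) : Conn H N u v := by
  induction p with
  | nil => exact .refl
  | @cons u w v h q ih =>
    rw [SimpleGraph.Walk.support_cons] at hp
    have hq : ∀ x ∈ q.support, x ∈ N := fun x hx => hp x (List.mem_cons_of_mem _ hx)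
    exact (Conn.single h (hp u List.mem_cons_self) (hq w q.start_mem_support)).trans (ih hq)

theorem IsFarey.reachable_treeGraph (hG : IsFarey G) {x y : V} (h : Conn G Set.univ x y) :
    (treeGraph G).Reachable (Sum.inl x) (Sum.inl y) := by
  induction h with
  | refl => exact .refl _
  | @tail b c _ hbc ih =>
    have h1 : (treeGraph G).Adj (Sum.inl b) (Sum.inr (edgeClass G hbc.1)) :=
      hG.left_mem_verts hbc.1
    have h2 : (treeGraph G).Adj (Sum.inr (edgeClass G hbc.1)) (Sum.inl c) :=
      hG.right_mem_verts hbc.1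
    exact ih.trans (h1.reachable.trans h2.reachable)

theorem reachable_nodeVerts {w : V ⊕ EdgeClass G} {x : V} (hx : x ∈ nodeVerts w) :
    (treeGraph G).Reachable w (Sum.inl x) := by
  cases w with
  | inl z => rw [Set.mem_singleton_iff.1 hx]
  | inr E =>
    have : (treeGraph G).Adj (Sum.inr E) (Sum.inl x) := hx
    exact this.reachable

/-! ### `conv_M(B)` is the least strong set containing `B` -/

theorem isConvex_convexHull {W : Type*} (H : SimpleGraph W) (S : Set W) :
    IsConvex H (convexHull H S) := by
  intro u v hu hv p hp w hw C hC
  exact hC.2 (hu C hC) (hv C hC) p hp w hw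

/-- The nodes of the bipartite graph that lie in a set of vertices. -/
def nodesIn (C : Set V) : Set (V ⊕ EdgeClass G) := {w | nodeVerts w ⊆ C}

/-- The first node inside `C` cannot be a class: it would be entered from one of its vertices, which
would already lie in `C`. -/
theorem exists_conn_entry {C : Set V} {w v : V ⊕ EdgeClass G} (q : (treeGraph G).Walk w v)
    (hw : w ∉ nodesIn C) (hv : v ∈ nodesIn C) :
    ∃ t ∈ C, Sum.inl t ∈ q.support ∧ Conn (treeGraph G) {n | ∀ E, n = Sum.inr E → ¬ E.verts ⊆ C}
      w (Sum.inl t) := by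
  have hN : ∀ w : V ⊕ EdgeClass G, w ∉ nodesIn C → w ∈ {n : V ⊕ EdgeClass G |
      ∀ E, n = Sum.inr E → ¬ E.verts ⊆ C} := by
    rintro w hw E rfl h
    exact hw h
  induction q with
  | nil => exact absurd hv hw
  | @cons w w' v h q ih =>
    by_cases hw' : w' ∈ nodesIn C
    · cases w' with
      | inl t =>
        refine ⟨t, hw' rfl, List.mem_cons_of_mem _ q.start_mem_support, .single h (hN _ hw) ?_⟩
        rintro E ⟨⟩
      | inr E =>
        cases w with
        | inl x =>
          refine absurd ?_ hw
          rintro _ rfl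
          exact hw' h
        | inr E' => exact h.elim
    · obtain ⟨t, ht, hts, hc⟩ := ih hw' hv
      exact ⟨t, ht, List.mem_cons_of_mem _ hts, (Conn.single h (hN _ hw) (hN _ hw')).trans hc⟩

/-- From a node of a geodesic outside `C`, follow it both ways until it enters `C`. The resulting
walk in `G` between the entry points uses no edge inside `C`, so they coincide, and the geodesic
visits a vertex twice. -/
theorem IsFarey.isConvex_nodesIn (hG : IsFarey G) {C : Set V} (hC : Strong G C) :
    IsConvex (treeGraph G) (nodesIn C) := by
  classical
  intro u v hu hv p hp w hw
  by_contra hwC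
  have hpath := p.isPath_of_length_eq_dist hp
  obtain ⟨s, hs, hsp, hws⟩ := exists_conn_entry (p.takeUntil w hw).reverse hwC hu
  obtain ⟨t, ht, htp, hwt⟩ := exists_conn_entry (p.dropUntil w hw) hwC hv
  have h1 := hG.reflTransGen_of_treeGraph (by rintro E ⟨⟩) (hws.symm.trans hwt) s rfl t rfl
  have hst : s = t := by
    refine hG.eq_of_strong hC hs ht (reflTransGen_mono ?_ h1)
    rintro a b ⟨hab, hN⟩
    refine ⟨hab, fun h => hN _ rfl ?_⟩
    rw [hG.verts_edgeClass]
    refine tcl_subset hC.tri ?_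
    rintro _ (rfl | rfl)
    exacts [h.1, h.2]
  subst hst
  rw [SimpleGraph.Walk.support_reverse, List.mem_reverse] at hsp
  have hnd := hpath.support_nodup
  rw [← p.take_spec hw, SimpleGraph.Walk.support_append, List.nodup_append] at hnd
  rw [SimpleGraph.Walk.mem_support_iff] at htp
  rcases htp with h | h
  · refine hwC ?_
    rw [← h]
    rintro _ rfl
    exact hs
  · exact hnd.2.2 _ hsp _ h rfl

theorem IsFarey.convM_subset (hG : IsFarey G) {B C : Set V} (hC : Strong G C) (hBC : B ⊆ C) :
    convM G B ⊆ C := by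
  rintro x (hx | ⟨E, hE, hx⟩)
  · exact hBC hx
  · refine hE (nodesIn C) ⟨?_, hG.isConvex_nodesIn hC⟩ hx
    rintro _ ⟨b, hb, rfl⟩ _ rfl
    exact hBC hb

/-- Geodesics between hull nodes stay in the hull, so reachable points of `convM` are joined using
only edges whose classes lie in the hull. -/
theorem IsFarey.strong_convM (hG : IsFarey G) (B : Set V) : Strong G (convM G B) := by
  have hnode : ∀ x ∈ convM G B, ∃ w ∈ convexHull (treeGraph G) (Sum.inl '' B),
      x ∈ nodeVerts w := by
    rintro x (hx | ⟨E, hE, hx⟩)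
    · exact ⟨Sum.inl x, fun C hC => hC.1 ⟨x, hx, rfl⟩, rfl⟩
    · exact ⟨Sum.inr E, hE, hx⟩
  have key : ∀ s ∈ convM G B, ∀ t ∈ convM G B, Conn G Set.univ s t →
      Relation.ReflTransGen (fun a b => ∃ hab : G.Adj a b,
        Sum.inr (edgeClass G hab) ∈ convexHull (treeGraph G) (Sum.inl '' B)) s t := by
    intro s hs t ht hst
    obtain ⟨w, hw, hsw⟩ := hnode s hs
    obtain ⟨w', hw', htw⟩ := hnode t ht
    have hreach : (treeGraph G).Reachable w w' :=
      ((reachable_nodeVerts hsw).trans (hG.reachable_treeGraph hst)).trans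
        (reachable_nodeVerts htw).symm
    obtain ⟨p, hp⟩ := hreach.exists_walk_length_eq_dist
    exact hG.reflTransGen_of_treeGraph hw
      (conn_of_walk p (isConvex_convexHull _ _ hw hw' p hp)) s hsw t htw
  refine ⟨fun x y z hx hy hxy hxz hyz => ?_, fun s hs t ht hst => ?_⟩
  · refine Or.inr ⟨edgeClass G hxy, ?_, ?_⟩
    -- If the class of the edge were missing from the hull, the walk given by `key` would join two
    -- points of this strong class without using its edges, so they would be equal.
    · by_contra hn
      refine hxy.ne (hG.eq_of_strong (hG.strong_verts (edgeClass G hxy)) (hG.left_mem_verts hxy)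
        (hG.right_mem_verts hxy)
        (reflTransGen_mono ?_ (key x hx y hy (.single hxy trivial trivial))))
      rintro a b ⟨hab, h⟩
      refine ⟨hab, fun hE => hn ?_⟩
      rwa [← hG.edgeClass_eq hab hE.1 hE.2]
    · exact (hG.strong_verts _).tri (hG.left_mem_verts hxy) (hG.right_mem_verts hxy) hxy hxz hyz
  · refine reflTransGen_mono ?_ (key s hs t ht hst)
    rintro a b ⟨hab, h⟩
    exact ⟨hab, Or.inr ⟨_, h, hG.left_mem_verts hab⟩, Or.inr ⟨_, h, hG.right_mem_verts hab⟩⟩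

end Hull

/-! ### Algebraic closure and transfer to the ultrapower. -/

section Acl

variable {M : Type*}

/-! ### The algebraic closure is strong -/

theorem subset_acl (L : Language) [L.Structure M] (A : Set M) : A ⊆ acl L A :=
  fun a ha => ⟨{a}, Set.Definable.singleton_of_mem L ha, Set.finite_singleton a, rfl⟩

/-- The algebraic closure is closed under definable relations with finite fibres. -/
theorem mem_acl_of_definable {L : Language} [L.Structure M] {A : Set M} {R : Set (Fin 3 → M)}
    (hR : A.Definable L R) (hfin : ∀ x y, {z | ![x, y, z] ∈ R}.Finite) {c d e : M}
    (hc : c ∈ acl L A) (hd : d ∈ acl L A) (he : ![c, d, e] ∈ R) : e ∈ acl L A := by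
  obtain ⟨D₁, hD₁, hf₁, hcD⟩ := hc
  obtain ⟨D₂, hD₂, hf₂, hdD⟩ := hd
  refine ⟨⋃ x ∈ D₁, ⋃ y ∈ D₂, {z | ![x, y, z] ∈ R}, ?_,
    hf₁.biUnion fun x _ => hf₂.biUnion fun y _ => hfin x y,
    Set.mem_biUnion hcD (Set.mem_biUnion hdD he)⟩
  have h := (((hD₁.preimage_comp (fun _ : Fin 1 => (0 : Fin 3))).inter
    (hD₂.preimage_comp (fun _ : Fin 1 => (1 : Fin 3)))).inter hR).image_comp
      (fun _ : Fin 1 => (2 : Fin 3))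
  unfold Set.Definable₁
  convert! h using 1
  ext v
  simp only [Set.mem_iUnion, Set.mem_image]
  constructor
  · rintro ⟨x, hx, y, hy, h⟩
    refine ⟨![x, y, v 0], ⟨⟨hx, hy⟩, h⟩, ?_⟩
    ext i
    fin_cases i
    rfl
  · rintro ⟨w, ⟨⟨hx, hy⟩, h⟩, rfl⟩
    refine ⟨w 0, hx, w 1, hy, ?_⟩
    have : w = ![w 0, w 1, w 2] := by ext i; fin_cases i <;> rfl
    rw [this] at h
    exact h

variable [Language.graph.Structure M]

theorem graphOf_adj (hM : M ⊨ T) (x y : M) :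
    Structure.RelMap adj ![x, y] ↔ (graphOf hM).Adj x y := Iff.rfl

theorem isFarey_graphOf (hM : M ⊨ T) : IsFarey (graphOf hM) := by
  have : M ⊨ Theory.simpleGraph :=
    hM.mono (Set.subset_union_left.trans Set.subset_union_left)
  have hs : (graphOf hM).structure = ‹Language.graph.Structure M› :=
    structure_simpleGraphOfStructure
  obtain ⟨h1, h2, h3⟩ := (model_T_iff (graphOf hM)).1 (by rw [hs]; exact hM)
  exact ⟨h1, h2, h3⟩

theorem definable_adj (hM : M ⊨ T) (A : Set M) {α : Type*} (i j : α) :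
    A.Definable Language.graph {v : α → M | (graphOf hM).Adj (v i) (v j)} := by
  refine Set.Definable.mono (A := ∅) (Set.empty_definable_iff.2
    ⟨adj.formula₂ (Term.var i) (Term.var j), ?_⟩) (Set.empty_subset A)
  ext v
  change _ ↔ Formula.Realize _ v
  rw [Formula.realize_rel₂]
  rfl

/-- Having distance at most `n` is definable. -/
theorem definable_ball (hM : M ⊨ T) (A : Set M) (n : ℕ) :
    A.Definable Language.graph {v : Fin 2 → M |
      (graphOf hM).Reachable (v 0) (v 1) ∧ (graphOf hM).dist (v 0) (v 1) ≤ n} := by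
  induction n with
  | zero =>
    have h := Set.Definable.diagonal Language.graph A
    unfold Set.Definable₂ at h
    convert! h using 1
    ext v
    simp only [Set.mem_ofPred_eq, Nat.le_zero, Set.mem_diagonal_iff]
    constructor
    · rintro ⟨h, h'⟩
      exact h.dist_eq_zero_iff.1 h'
    · intro h
      rw [h]
      exact ⟨.refl _, SimpleGraph.dist_self⟩
  | succ n ih =>
    have h := ((definable_adj hM A (0 : Fin 3) 2).inter
      (ih.preimage_comp ![(2 : Fin 3), 1])).image_comp ![(0 : Fin 3), 1]
    convert! ih.union h using 1
    ext v
    simp only [Set.mem_union, Set.mem_image]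
    constructor
    · rintro ⟨hr, hd⟩
      rcases Nat.lt_or_ge n ((graphOf hM).dist (v 0) (v 1)) with hn | hn
      · obtain ⟨u, hvu, hub, hu⟩ := IsFarey.exists_adj_dist hr (by omega : _ = n + 1)
        refine Or.inr ⟨![v 0, v 1, u], ⟨hvu, hub, hu.le⟩, ?_⟩
        ext i
        fin_cases i <;> rfl
      · exact Or.inl ⟨hr, hn⟩
    · rintro (⟨hr, hd⟩ | ⟨w, ⟨h1, h2, h3⟩, rfl⟩)
      · exact ⟨hr, hd.trans (Nat.le_succ n)⟩
      · have h1' : (graphOf hM).Adj (w 0) (w 2) := h1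
        exact ⟨h1'.reachable.trans h2,
          (IsFarey.dist_le_of_adj h2 h1').trans (Nat.succ_le_succ h3)⟩

/-- Third vertices of triangles and first vertices of geodesics of a given length are given by
definable relations with finite fibres, so geodesics between algebraic points stay algebraic. -/
theorem strong_acl (hM : M ⊨ T) (A : Set M) : Strong (graphOf hM) (acl Language.graph A) := by
  have hG := isFarey_graphOf hM
  refine ⟨fun x y z hx hy hxy hxz hyz => ?_, fun s hs t ht hst => ?_⟩
  · refine mem_acl_of_definable (((definable_adj hM A (0 : Fin 3) 1).inter
      (definable_adj hM A (0 : Fin 3) 2)).inter (definable_adj hM A (1 : Fin 3) 2))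
      (fun x y => ?_) hx hy ⟨⟨hxy, hxz⟩, hyz⟩
    by_cases h : (graphOf hM).Adj x y
    · exact (Set.finite_of_encard_eq_coe (k := 2) (hG.triangle x y h)).subset
        fun z hz => ⟨hz.1.2, hz.2⟩
    · convert! Set.finite_empty (α := M)
      exact Set.eq_empty_of_forall_notMem fun z hz => h hz.1.1
  · have hreach : (graphOf hM).Reachable s t := by
      rw [SimpleGraph.reachable_iff_reflTransGen]
      exact reflTransGen_mono (fun _ _ h => h.1) hst
    clear hst
    induction hn : (graphOf hM).dist s t generalizing s with
    | zero => rw [hreach.dist_eq_zero_iff.1 hn]; exact .refl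
    | succ n ih =>
      obtain ⟨z, hsz, hzt, hz⟩ := IsFarey.exists_adj_dist hreach hn
      have hzA : z ∈ acl Language.graph A := by
        refine mem_acl_of_definable
          ((((definable_ball hM A (n + 1)).sdiff (definable_ball hM A n)).preimage_comp
            ![(0 : Fin 3), 1]).inter ((definable_adj hM A (0 : Fin 3) 2).inter
            ((definable_ball hM A n).preimage_comp ![(2 : Fin 3), 1])))
          (fun x y => ?_) hs ht
          ⟨⟨⟨hreach, hn.le⟩, fun h => absurd (h.2.trans_eq' hn) (by simp)⟩, hsz, hzt, hz.le⟩
        by_cases hxy : (graphOf hM).dist x y = n + 1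
        · refine (hG.finite_geodesic hxy).subset ?_
          rintro w ⟨-, h2, h3, h4⟩
          have h2' : (graphOf hM).Adj x w := h2
          have h4' : (graphOf hM).dist w y ≤ n := h4
          have : (graphOf hM).dist x y ≤ (graphOf hM).dist w y + 1 :=
            IsFarey.dist_le_of_adj h3 h2'
          exact ⟨h2, h3, by omega⟩
        · convert! Set.finite_empty (α := M)
          refine Set.eq_empty_of_forall_notMem ?_
          rintro w ⟨⟨⟨h1, h2⟩, h3⟩, -⟩
          have h2' : (graphOf hM).dist x y ≤ n + 1 := h2
          exact h3 ⟨h1, show (graphOf hM).dist x y ≤ n by omega⟩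
      exact (Conn.single hsz hs hzA).trans (ih z hzA hzt hz)

theorem convM_subset_acl (hM : M ⊨ T) (A : Set M) :
    convM (graphOf hM) A ⊆ acl Language.graph A :=
  (isFarey_graphOf hM).convM_subset (strong_acl hM A) (subset_acl _ A)

/-! ### The ultrapower -/

/-- The ultrapower of `M` over a nonprincipal ultrafilter on the natural numbers. -/
abbrev Ultrapower (M : Type*) : Type _ :=
  ((Filter.hyperfilter ℕ : Ultrafilter ℕ) : Filter ℕ).Product fun _ => M

/-- The element of the ultrapower represented by a sequence. -/
def ofSeq (f : ℕ → M) : Ultrapower M := (f : Ultrapower M)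

omit [Language.graph.Structure M] in
theorem exists_ofSeq (x : Ultrapower M) : ∃ f : ℕ → M, x = ofSeq f := by
  induction x using Quotient.inductionOn with
  | _ f => exact ⟨f, rfl⟩

omit [Language.graph.Structure M] in
theorem ofSeq_eq {f g : ℕ → M} :
    ofSeq f = ofSeq g ↔ ∀ᶠ n in (Filter.hyperfilter ℕ : Filter ℕ), f n = g n :=
  Quotient.eq''

theorem ultrapower_model [Nonempty M] (hM : M ⊨ T) : Ultrapower M ⊨ T := by
  rw [Theory.model_iff] at hM ⊢
  intro φ hφ
  rw [Ultraproduct.sentence_realize]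
  exact Filter.Eventually.of_forall fun _ => hM φ hφ

section

variable [Nonempty M] (hM : M ⊨ T)

theorem adj_ofSeq {f g : ℕ → M} : (graphOf (ultrapower_model hM)).Adj (ofSeq f) (ofSeq g) ↔
    ∀ᶠ n in (Filter.hyperfilter ℕ : Filter ℕ), (graphOf hM).Adj (f n) (g n) := by
  have h := Ultraproduct.realize_formula_cast (M := fun _ : ℕ => M) (u := Filter.hyperfilter ℕ)
    (adj.formula₂ (Term.var (0 : Fin 2)) (Term.var 1) : Language.graph.Formula (Fin 2)) ![f, g]
  simp only [Formula.realize_rel₂] at h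
  exact h

theorem eventually_walk {a b : Ultrapower M} (p : (graphOf (ultrapower_model hM)).Walk a b)
    (f g : ℕ → M) (hf : a = ofSeq f) (hg : b = ofSeq g) :
    ∀ᶠ n in (Filter.hyperfilter ℕ : Filter ℕ),
      ∃ q : (graphOf hM).Walk (f n) (g n), q.length = p.length := by
  induction p generalizing f with
  | nil =>
    filter_upwards [ofSeq_eq.1 (hf.symm.trans hg)] with n hn
    exact ⟨SimpleGraph.Walk.nil.copy rfl hn, by simp⟩
  | @cons a c b h p ih =>
    obtain ⟨e, rfl⟩ := exists_ofSeq c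
    subst hf
    filter_upwards [ih e rfl hg, (adj_ofSeq hM).1 h] with n ⟨q, hq⟩ hn
    exact ⟨.cons hn q, by simp [hq]⟩

theorem rich_ultrapower : Rich (graphOf (ultrapower_model hM)) := by
  have hG := isFarey_graphOf hM
  have hG' := isFarey_graphOf (ultrapower_model hM)
  refine { hG' with many := ?_, far := ?_ }
  · intro x C hC
    obtain ⟨f, rfl⟩ := exists_ofSeq x
    rcases C.eq_empty_or_nonempty with rfl | hne
    · obtain ⟨y, hy⟩ := hG'.edge (ofSeq f)
      exact ⟨y, Set.notMem_empty y, hy⟩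
    · obtain ⟨s, rfl⟩ := hC.exists_eq_range hne
      choose r hr using fun i => exists_ofSeq (s i)
      -- Diagonalisation: the `n`-th coordinate avoids the first `n + 1` listed elements, so the new
      -- neighbour differs from each listed element at almost all coordinates.
      have hex : ∀ n, ∃ y, (graphOf hM).Adj (f n) y ∧ ∀ i ≤ n, y ≠ r i n := by
        intro n
        obtain ⟨y, hy, hyn⟩ := ((hG.infinite_neighborSet (f n)).sdiff
          ((Set.finite_Iic n).image fun i => r i n)).nonempty
        exact ⟨y, hy, fun i hi e => hyn ⟨i, hi, e.symm⟩⟩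
      choose y hy hyr using hex
      refine ⟨ofSeq y, ?_, (adj_ofSeq hM).2 (Filter.Eventually.of_forall hy)⟩
      rintro ⟨i, hi⟩
      rw [hr i, ofSeq_eq] at hi
      have hge : ∀ᶠ n in (Filter.hyperfilter ℕ : Filter ℕ), i ≤ n :=
        Nat.hyperfilter_le_atTop (Filter.eventually_ge_atTop i)
      obtain ⟨n, h1, h2⟩ := (hi.and hge).exists
      exact hyr n i h2 h1.symm
  · intro X hX
    choose r hr using fun x : Ultrapower M => exists_ofSeq x
    -- Distances grow with the coordinate, whereas a walk in the ultrapower has one fixed finite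
    -- length at almost all coordinates.
    have hex : ∀ n, ∃ v, ∀ b ∈ (fun x => r x n) '' X, (graphOf hM).Reachable v b →
        n ≤ (graphOf hM).dist v b := fun n => hG.exists_far (hX.image _) n
    choose v hv using hex
    refine ⟨ofSeq v, fun x hx hc => ?_⟩
    have hreach : (graphOf (ultrapower_model hM)).Reachable (ofSeq v) x := by
      rw [SimpleGraph.reachable_iff_reflTransGen]
      exact reflTransGen_mono (fun _ _ h => h.1) hc.symm
    obtain ⟨p⟩ := hreach
    have hgt : ∀ᶠ n in (Filter.hyperfilter ℕ : Filter ℕ), p.length < n :=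
      Nat.hyperfilter_le_atTop (Filter.eventually_gt_atTop p.length)
    obtain ⟨n, ⟨q, hq⟩, hn⟩ := ((eventually_walk hM p v (r x) rfl (hr x)).and hgt).exists
    have h1 := hv n (r x n) ⟨x, hx, rfl⟩ q.reachable
    have h2 := SimpleGraph.dist_le q
    omega

/-- This lets a strong set of `M` be used in the ultrapower. An edge has two common neighbours, of
which the ultrafilter selects one, so no new triangle appears; a walk in the ultrapower projects to
a walk in `M` at some coordinate. -/
theorem strong_image {S : Set M} (hS : Strong (graphOf hM) S) :
    Strong (graphOf (ultrapower_model hM)) ((fun x => ofSeq fun _ => x) '' S) := by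
  have hG := isFarey_graphOf hM
  have hadj : ∀ x y : M, (graphOf (ultrapower_model hM)).Adj (ofSeq fun _ => x) (ofSeq fun _ => y) ↔
      (graphOf hM).Adj x y := fun x y => by
    rw [adj_ofSeq, Filter.eventually_const]
  refine ⟨?_, ?_⟩
  · rintro _ _ z ⟨x, hx, rfl⟩ ⟨y, hy, rfl⟩ hxy hxz hyz
    obtain ⟨f, rfl⟩ := exists_ofSeq z
    rw [hadj] at hxy
    obtain ⟨a, b, -, hab⟩ := hG.exists_triangle hxy
    have ha := (hab a).2 (Or.inl rfl)
    have hb := (hab b).2 (Or.inr rfl)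
    have h : ∀ᶠ n in (Filter.hyperfilter ℕ : Filter ℕ), f n = a ∨ f n = b := by
      filter_upwards [(adj_ofSeq hM).1 hxz, (adj_ofSeq hM).1 hyz] with n h1 h2
      exact (hab _).1 ⟨h1, h2⟩
    rcases Ultrafilter.eventually_or.1 h with h | h
    · exact ⟨a, hS.tri hx hy hxy ha.1 ha.2, (ofSeq_eq.2 h).symm⟩
    · exact ⟨b, hS.tri hx hy hxy hb.1 hb.2, (ofSeq_eq.2 h).symm⟩
  · rintro _ ⟨s, hs, rfl⟩ _ ⟨t, ht, rfl⟩ hst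
    have hreach : (graphOf (ultrapower_model hM)).Reachable
        (ofSeq fun _ => s) (ofSeq fun _ => t) := by
      rw [SimpleGraph.reachable_iff_reflTransGen]
      exact reflTransGen_mono (fun _ _ h => h.1) hst
    obtain ⟨p⟩ := hreach
    obtain ⟨n, q, -⟩ := (eventually_walk hM p _ _ rfl rfl).exists
    have hc := hS.conn s hs t ht (conn_of_walk q fun _ _ => Set.mem_univ _)
    clear p q hst
    induction hc with
    | refl => exact .refl
    | tail _ h ih =>
      exact (ih h.2.1).trans (.single ((hadj _ _).2 h.1) ⟨_, h.2.1, rfl⟩ ⟨_, h.2.2, rfl⟩)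

theorem realize_ofSeq {A : Set M} (φ : Language.graph.Formula (A ⊕ Fin 1)) (f : ℕ → M) :
    φ.Realize (Sum.elim (fun a : A => ofSeq fun _ => (a : M)) fun _ => ofSeq f) ↔
      ∀ᶠ n in (Filter.hyperfilter ℕ : Filter ℕ), φ.Realize (Sum.elim (↑) fun _ => f n) := by
  have h := Ultraproduct.realize_formula_cast (M := fun _ : ℕ => M) (u := Filter.hyperfilter ℕ)
    φ (Sum.elim (fun a _ => (a : M)) fun _ => f)
  convert! h using 2
  · ext i; cases i <;> rfl
  · ext; congr! 1; ext i; cases i <;> rfl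

end

/-- A point of `D` outside `convM` would have a conjugate over `A` in the ultrapower outside the
image of `D`. By Łoś its coordinates lie in the finite set `D` almost everywhere, hence are almost
everywhere one fixed element of `D`: a contradiction. -/
theorem acl_subset_convM (hM : M ⊨ T) {A : Set M} (hA : A.Finite) :
    acl Language.graph A ⊆ convM (graphOf hM) A := by
  rintro b ⟨D, hD, hfin, hbD⟩
  by_contra hb
  have : Nonempty M := ⟨b⟩
  set j : M → Ultrapower M := fun x => ofSeq fun _ => x with hj
  have hinj : Function.Injective j := fun x y h => by
    simpa only [Filter.eventually_const] using ofSeq_eq.1 h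
  obtain ⟨φ, hφ⟩ := Set.definable_iff_exists_formula_sum.1 hD
  have hφD : ∀ x, φ.Realize (Sum.elim (↑) fun _ => x) ↔ x ∈ D := fun x =>
    (Set.ext_iff.1 hφ fun _ => x).symm
  have hrich := rich_ultrapower hM
  obtain ⟨b', hb', p, hp, hAp, hbp⟩ := hrich.exists_conjugate
    (strong_image hM ((isFarey_graphOf hM).strong_convM A)) (hA.image j)
    (Set.image_mono fun a ha => Or.inl ha) (b := j b)
    (fun ⟨x, hx, e⟩ => hb (hinj e ▸ hx)) (hfin.image j)
  obtain ⟨f, rfl⟩ := exists_ofSeq b'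
  have h1 : φ.Realize (Sum.elim (fun a : A => j a) fun _ => j b) :=
    (realize_ofSeq φ _).2 (Filter.Eventually.of_forall fun _ => (hφD b).2 hbD)
  have h2 : φ.Realize (Sum.elim (fun a : A => j a) fun _ => ofSeq f) := by
    refine (hp.realize_iff hrich (graphOf_adj _) φ (xs := default) (ys := default) ?_
      (fun i => i.elim0)).1 h1
    rintro (a | i)
    · exact hAp _ ⟨a, a.2, rfl⟩
    · exact hbp
  have h3 := (realize_ofSeq φ f).1 h2
  simp only [hφD] at h3
  have h4 : (⋃ d ∈ D, {n | f n = d}) ∈ Filter.hyperfilter ℕ :=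
    Filter.mem_of_superset h3 fun n hn => Set.mem_biUnion hn rfl
  obtain ⟨d, hd, hfd⟩ := (Ultrafilter.finite_biUnion_mem_iff hfin).1 h4
  exact hb' ⟨d, hd, (ofSeq_eq.2 hfd).symm⟩

end Acl
end FareyModel

end

theorem mainTheorem3 {M : Type*} [Language.graph.Structure M] (hM : M ⊨ FareyModel.T)
    (A : Set M) (hA : A.Finite) :
    FareyModel.acl Language.graph A = FareyModel.convM (FareyModel.graphOf hM) A :=
  (FareyModel.acl_subset_convM hM hA).antisymm (FareyModel.convM_subset_acl hM A)
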